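/- Let $\mathbb D=\{|z|<1\}$, $\mathbb T=\partial\mathbb D$ and $d_{\mathbb D}(z)=\operatorname{dist}(z,\mathbb T)$. A *majorant* is a continuous increasing (not necessarily strictly) function $\omega:[0,\infty)\to[0,\infty)$ with $\omega(0)=0$ such that $\omega(t)/t$ is non-increasing on $(0,\infty)$. It is *regular* if there are constants $\delta_0,M>0$ such that for all $0<\delta<\delta_0$ $$\int_0^\delta\frac{\omega(t)}t\,dt\le M\omega(\delta)\quad\text{and}\quad \delta\int_\delta^\infty\frac{\omega(t)}{t^2}\,dt\le M\omega(\delta).$$ For $p\in[1,\infty)$ put $\mathcal L_p[f](z_1,z_2)=\left(\int_0^{2\pi}|f(e^{i\eta}z_1)-f(e^{i\eta}z_2)|^p\,d\eta\right)^{1/p}$, and put $\mathcal L_\infty[f](z_1,z_2)=|f(z_1)-f(z_2)|$. Let $\Lambda_{\omega,p}(\mathbb D)$ be the class of Borel functions $f:\mathbb D\to\mathbb C$ for which there is $M>0$ with $\mathcal L_p[f](z_1,z_2)\le M\omega(|z_1-z_2|)$ for all $z_1,z_2\in\mathbb D$, and let $\Lambda_{\omega,p}(\mathbb T)$ be the class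 of $\varphi\in L^p(\mathbb T)$ for which there is $M>0$ with $\mathcal L_p[\varphi](\xi_1,\xi_2)\le M\omega(|\xi_1-\xi_2|)$ for all $\xi_1,\xi_2\in\mathbb T$. For $K\ge1$, a continuous map $f:\mathbb D\to\mathbb C$ is *$K$-quasiregular* if it is absolutely continuous on lines with locally square integrable partial derivatives in $\mathbb D$ and, almost everywhere in $\mathbb D$, $J_f=|f_z|^2-|f_{\bar z}|^2>0$ and $(|f_z|+|f_{\bar z}|)^2\le K J_f$. For $\varphi$ integrable on $\mathbb T$ let $P[\varphi](z)=\frac1{2\pi}\int_0^{2\pi}\varphi(e^{i\tau})\frac{1-|z|^2}{|e^{i\tau}-z|^2}\,d\tau$, $z\in\mathbb D$, be its Poisson integral; $P[|f|]$ is the Poisson integral of the boundary function of $|f|$. **Theorem.** Let $p\in[1,\infty]$, let $\omega$ be a regular majorant, let $K\in[1,\infty)$, and let $f:\mathbb D\to\mathbb C$ be a harmonic $K$-quasiregular map that extends continuously to $\overline{\mathbb D}$. Suppose that the boundary function of $|f|$ belongs to $\Lambda_{\omega,p}(\mathbb T)$. Then the following are equivalent. 1. $f\in\Lambda_{\omega,p}(\mathbb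 D)$. 2. There is a constant $M>0$ such that for all $z\in\mathbb D$ $$\left(\int_0^{2\pi}\bigl(P[|f|](ze^{i\eta})-|f(ze^{i\eta})|\bigr)^p\,d\eta\right)^{1/p}\le M\omega(d_{\mathbb D}(z))\quad\text{if }p<\infty,$$ $$P[|f|](z)-|f(z)|\le M\omega(d_{\mathbb D}(z))\quad\text{if }p=\infty.$$ -/

import Mathlib

open MeasureTheory Set

noncomputable section

/-- The open unit disk. -/
def unitDisk : Set ℂ := Metric.ball 0 1

/-- Euclidean distance from `z` to the boundary of the unit disk. -/
def bdryDist (z : ℂ) : ℝ := Metric.infDist z (frontier unitDisk)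

/-- A majorant: a continuous increasing function `ω` on `[0, ∞)` with `ω 0 = 0` for which
`ω t / t` is non-increasing on `(0, ∞)`. Only the values of `ω` on `[0, ∞)` matter;
nonnegativity there follows from `zero` and `mono`. -/
structure IsMajorant (ω : ℝ → ℝ) : Prop where
  continuousOn : ContinuousOn ω (Ici 0)
  mono : MonotoneOn ω (Ici 0)
  zero : ω 0 = 0
  anti : AntitoneOn (fun t : ℝ => ω t / t) (Ioi 0)

/-- `∫₀^δ ω(t)/t dt ≤ M ω(δ)` for all small `δ` (convergence of the integral included). -/
def IsFast (ω : ℝ → ℝ) : Prop :=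
  ∃ δ₀ : ℝ, 0 < δ₀ ∧ ∃ M : ℝ, 0 < M ∧ ∀ δ : ℝ, 0 < δ → δ < δ₀ →
    IntegrableOn (fun t : ℝ => ω t / t) (Ioo 0 δ) ∧
      ∫ t in Ioo 0 δ, ω t / t ≤ M * ω δ

/-- `δ ∫_δ^∞ ω(t)/t² dt ≤ M ω(δ)` for all small `δ` (convergence of the integral included). -/
def IsSlow (ω : ℝ → ℝ) : Prop :=
  ∃ δ₀ : ℝ, 0 < δ₀ ∧ ∃ M : ℝ, 0 < M ∧ ∀ δ : ℝ, 0 < δ → δ < δ₀ →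
    IntegrableOn (fun t : ℝ => ω t / t ^ 2) (Ioi δ) ∧
      δ * ∫ t in Ioi δ, ω t / t ^ 2 ≤ M * ω δ

/-- A regular majorant is a majorant that is both fast and slow. -/
structure IsRegularMajorant (ω : ℝ → ℝ) : Prop where
  isMajorant : IsMajorant ω
  fast : IsFast ω
  slow : IsSlow ω

open Classical in
/-- `𝓛_p[f](z₁, z₂)`: the `L^p(0, 2π)` norm of `η ↦ f (e^{iη} z₁) - f (e^{iη} z₂)` if `p < ∞`, and
`|f z₁ - f z₂|` if `p = ∞`. Extended-valued, so that no integrability is presupposed. -/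
def rotDiff {E : Type*} [NormedAddCommGroup E] (p : ENNReal) (f : ℂ → E) (z₁ z₂ : ℂ) : ENNReal :=
  if p = ⊤ then ‖f z₁ - f z₂‖ₑ
  else eLpNorm (fun η : ℝ => f (Complex.exp (η * Complex.I) * z₁) -
    f (Complex.exp (η * Complex.I) * z₂)) p (volume.restrict (Ioc 0 (2 * Real.pi)))

/-- The class `Λ_{ω,p}(𝔻)`. -/
def MemLipDisk (ω : ℝ → ℝ) (p : ENNReal) (f : ℂ → ℂ) : Prop :=
  Measurable (fun z : unitDisk => f z) ∧
    ∃ M : ℝ, 0 < M ∧ ∀ z₁ ∈ unitDisk, ∀ z₂ ∈ unitDisk,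
      rotDiff p f z₁ z₂ ≤ ENNReal.ofReal (M * ω ‖z₁ - z₂‖)

/-- The class `Λ_{ω,p}(𝕋)`, for functions with values in `ℝ` or `ℂ` (or any normed group).
Only the values of `φ` on the unit circle matter. -/
def MemLipCircle {E : Type*} [NormedAddCommGroup E] (ω : ℝ → ℝ) (p : ENNReal) (φ : ℂ → E) :
    Prop :=
  MemLp (fun η : ℝ => φ (Complex.exp (η * Complex.I))) p
      (volume.restrict (Ioc 0 (2 * Real.pi))) ∧
    ∃ M : ℝ, 0 < M ∧ ∀ ξ₁ ∈ Metric.sphere (0 : ℂ) 1, ∀ ξ₂ ∈ Metric.sphere (0 : ℂ) 1,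
      rotDiff p φ ξ₁ ξ₂ ≤ ENNReal.ofReal (M * ω ‖ξ₁ - ξ₂‖)

/-- The Poisson integral
`P[φ](z) = (1/2π) ∫₀^{2π} φ(e^{iτ}) (1 - |z|²) / |e^{iτ} - z|² dτ` of `φ` on the unit circle. -/
def poissonInt (φ : ℂ → ℝ) (z : ℂ) : ℝ :=
  Real.circleAverage (fun ζ => φ ζ * poissonKernel 0 z ζ) 0 1

/-- `∂f/∂z = (f_x - i f_y) / 2`. -/
def dz (f : ℂ → ℂ) (z : ℂ) : ℂ :=
  (lineDeriv ℝ f z 1 - Complex.I * lineDeriv ℝ f z Complex.I) / 2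

/-- `∂f/∂z̄ = (f_x + i f_y) / 2`. -/
def dzbar (f : ℂ → ℂ) (z : ℂ) : ℂ :=
  (lineDeriv ℝ f z 1 + Complex.I * lineDeriv ℝ f z Complex.I) / 2

/-- The maximal directional derivative `|f_z| + |f_z̄|`. -/
def maxStretch (f : ℂ → ℂ) (z : ℂ) : ℝ := ‖dz f z‖ + ‖dzbar f z‖

/-- The Jacobian `|f_z|² - |f_z̄|²`. -/
def jac (f : ℂ → ℂ) (z : ℂ) : ℝ := ‖dz f z‖ ^ 2 - ‖dzbar f z‖ ^ 2

/-- Absolute continuity on lines: on every closed rectangle `[a, b] × [c, d] ⊆ Ω`, `f` is absolutely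
continuous on almost every horizontal and on almost every vertical segment. -/
def IsACL (f : ℂ → ℂ) (Ω : Set ℂ) : Prop :=
  ∀ a b c d : ℝ, a ≤ b → c ≤ d → (Icc a b ×ℂ Icc c d) ⊆ Ω →
    (∀ᵐ y ∂(volume.restrict (Icc c d)),
      AbsolutelyContinuousOnInterval (fun x : ℝ => f ⟨x, y⟩) a b) ∧
    (∀ᵐ x ∂(volume.restrict (Icc a b)),
      AbsolutelyContinuousOnInterval (fun y : ℝ => f ⟨x, y⟩) c d)

/-- `f` is `ACL²` in `Ω`: it is `ACL` and `f_x`, `f_y` are locally square integrable in `Ω`. -/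
def IsACL2 (f : ℂ → ℂ) (Ω : Set ℂ) : Prop :=
  IsACL f Ω ∧ ∀ C : Set ℂ, IsCompact C → C ⊆ Ω →
    MemLp (fun z => lineDeriv ℝ f z 1) 2 (volume.restrict C) ∧
    MemLp (fun z => lineDeriv ℝ f z Complex.I) 2 (volume.restrict C)

/-- `K`-quasiregular maps of a domain `Ω`. That such a map preserves the sense is expressed
analytically, by the positivity of the Jacobian almost everywhere. -/
structure IsQuasiregularOn (K : ℝ) (f : ℂ → ℂ) (Ω : Set ℂ) : Prop where
  continuousOn : ContinuousOn f Ω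
  acl2 : IsACL2 f Ω
  jac_pos : ∀ᵐ z ∂(volume.restrict Ω), 0 < jac f z
  distortion : ∀ᵐ z ∂(volume.restrict Ω), maxStretch f z ^ 2 ≤ K * jac f z

end

/-! Fix z in the disk, put d = 1 - |z|, and let ξ be a point of the circle with z = |z|ξ.

From 1 to 2, the triangle inequality gives P[|f|](z) - |f(z)| ≤ P[|f - f(ξ)|](z) + |f(ξ) - f(z)|.
The last term is a difference at distance d. The first averages the boundary differences f(e^{it}ξ)
- f(ξ) against the Poisson kernel. By Minkowski's integral inequality its L^p mean over rotations is
at most a multiple of the kernel integral of ω(|t|), which the slow condition bounds by a multiple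
of ω(d) (`eLpNorm_poissonInt_norm_sub_le`).

From 2 to 1, it suffices to bound the L^p mean of the derivative by a multiple of ω(d)/d, since the
fast condition makes this integrable up to the circle (`exists_rotNorm_le_of_eLpNorm_fderiv_le`).
Choose a unimodular l with l f(z) = |f(z)| and put u = Re(l f). On the circle |f| - u is
nonnegative, and its Poisson integral at z is exactly P[|f|](z) - |f(z)|. Hence P[|u - c|](z) is at
most that quantity plus P[||f| - c|](z), and the gradient of the harmonic function u at z is at most
(4/d) P[|u - c|](z), for every real c. By quasiregularity the norm of Df(z) is at most K times the
minimal stretch, hence at most K|∇u(z)|, so the single real function u controls all of f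
(`norm_fderiv_le`). With c = |f(ξ)|, the oscillation of |f| is again covered by
`eLpNorm_poissonInt_norm_sub_le`. -/

/-! ### Minkowski's integral inequality and essential bounds -/

/-- **Minkowski's integral inequality**: the `L^p` norm of an integral is at most the integral of
the `L^p` norms. -/
theorem eLpNorm_lintegral_le {α β : Type*} [MeasurableSpace α] [MeasurableSpace β]
    {μ : Measure α} {ν : Measure β} [IsFiniteMeasure μ] [SFinite ν] {p : ENNReal} (hp : 1 ≤ p)
    {F : α → β → ENNReal} (hF : Measurable (Function.uncurry F)) {B : β → ENNReal}
    (hB : AEMeasurable B ν) (h : ∀ᵐ y ∂ν, eLpNorm (fun x => F x y) p μ ≤ B y) :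
    eLpNorm (fun x => ∫⁻ y, F x y ∂ν) p μ ≤ ∫⁻ y, B y ∂ν := by
  wlog hBm : Measurable B generalizing B
  · rw [lintegral_congr_ae hB.ae_eq_mk]
    refine this hB.measurable_mk.aemeasurable ?_ hB.measurable_mk
    filter_upwards [h, hB.ae_eq_mk] with y hy hy'
    exact hy' ▸ hy
  rcases eq_or_ne p ⊤ with rfl | hpt
  · have hset : MeasurableSet {q : β × α | F q.2 q.1 ≤ B q.1} :=
      measurableSet_le (hF.comp measurable_swap) (hBm.comp measurable_fst)
    -- For p = ∞ the exceptional null set of x depends on y; Fubini exchanges the two quantifiers.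
    have h1 : ∀ᵐ y ∂ν, ∀ᵐ x ∂μ, F x y ≤ B y := by
      filter_upwards [h] with y hy
      rw [eLpNorm_exponent_top] at hy
      filter_upwards [ae_le_eLpNormEssSup (f := fun x => F x y) (μ := μ)] with x hx
      exact hx.trans hy
    rw [Measure.ae_ae_comm hset] at h1
    rw [eLpNorm_exponent_top]
    refine eLpNormEssSup_le_of_ae_enorm_bound ?_
    filter_upwards [h1] with x hx
    exact lintegral_mono_ae hx
  have hp0 : p ≠ 0 := (zero_lt_one.trans_le hp).ne'
  set r := p.toReal with hr
  have hr1 : 1 ≤ r := by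
    rw [hr, ← ENNReal.toReal_one]; exact ENNReal.toReal_mono hpt hp
  have hr0 : 0 < r := zero_lt_one.trans_le hr1
  set C := ∫⁻ y, B y ∂ν with hC
  rcases eq_or_ne C ⊤ with hCt | hCt
  · rw [hCt]; exact le_top
  set G : α → ENNReal := fun x => ∫⁻ y, F x y ∂ν with hG
  have hGm : Measurable G := hF.lintegral_prod_right'
  -- Truncation makes I = ∫ T^r finite, so that a power of I can be cancelled from I ≤ C · I^(1 -
  -- 1/r). That inequality comes from Hölder applied to F · T^(r - 1); monotone convergence then
  -- removes the truncation.
  set T : ℕ → α → ENNReal := fun n x => min (G x) n with hT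
  have hTm : ∀ n, Measurable (T n) := fun n => hGm.min measurable_const
  have hle : ∀ y, eLpNorm (fun x => F x y) p μ = (∫⁻ x, F x y ^ r ∂μ) ^ (1 / r) := fun y => by
    rw [eLpNorm_eq_lintegral_rpow_enorm_toReal hp0 hpt]; simp [hr]
  have key : ∀ n, ∫⁻ x, T n x ^ r ∂μ ≤ C ^ r := by
    intro n
    set I := ∫⁻ x, T n x ^ r ∂μ with hI
    have hIt : I ≠ ⊤ := by
      have : I ≤ ∫⁻ _, (n : ENNReal) ^ r ∂μ :=
        lintegral_mono fun x => ENNReal.rpow_le_rpow (min_le_right _ _) hr0.le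
      refine (this.trans_lt ?_).ne
      rw [lintegral_const]
      exact ENNReal.mul_lt_top (ENNReal.rpow_lt_top_of_nonneg hr0.le (by simp))
        (measure_lt_top _ _)
    have h2 : I ≤ ∫⁻ x, ∫⁻ y, F x y * T n x ^ (r - 1) ∂ν ∂μ := by
      refine lintegral_mono fun x => ?_
      have hFx : Measurable fun y => F x y := hF.comp measurable_prodMk_left
      rw [lintegral_mul_const _ hFx]
      have : T n x ^ r = T n x * T n x ^ (r - 1) := by
        conv_rhs => rw [← ENNReal.rpow_one (T n x), ← ENNReal.rpow_mul, one_mul]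
        rw [← ENNReal.rpow_add_of_nonneg _ _ zero_le_one (by linarith)]
        congr 1; ring
      simp only
      rw [this]
      gcongr
      exact min_le_left _ _
    have h3 : I ≤ C * I ^ (1 - 1 / r) := by
      refine h2.trans ?_
      rw [lintegral_lintegral_swap
        (hF.mul (((hTm n).comp measurable_fst).pow_const _)).aemeasurable]
      rw [hC, ← lintegral_mul_const _ hBm]
      refine lintegral_mono_ae ?_
      filter_upwards [h] with y hy
      rw [hle] at hy
      have hFy : Measurable fun x => F x y := hF.comp measurable_prodMk_right
      rcases hr1.eq_or_lt with hr1 | hr1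
      · simpa [← hr1] using hy
      · have hpq : r.HolderConjugate (r / (r - 1)) := Real.HolderConjugate.conjExponent hr1
        refine (ENNReal.lintegral_mul_le_Lp_mul_Lq μ hpq hFy.aemeasurable
          ((hTm n).pow_const _).aemeasurable).trans ?_
        have e1 : ∀ x, (T n x ^ (r - 1)) ^ (r / (r - 1)) = T n x ^ r := fun x => by
          rw [← ENNReal.rpow_mul]; congr 1; field_simp [(sub_pos.2 hr1).ne']
        have e2 : 1 / (r / (r - 1)) = 1 - 1 / r := by field_simp
        simp only [e1, e2]
        gcongr
    rcases eq_or_ne I 0 with hI0 | hI0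
    · rw [hI0]; exact zero_le
    have hexp : I = I ^ (1 / r) * I ^ (1 - 1 / r) := by
      rw [← ENNReal.rpow_add _ _ hI0 hIt]; simp
    have hne : I ^ (1 - 1 / r) ≠ 0 := by simp [ENNReal.rpow_eq_zero_iff, hI0, hIt]
    have hnt : I ^ (1 - 1 / r) ≠ ⊤ := by simp [ENNReal.rpow_eq_top_iff, hI0, hIt]
    have h4 : I ^ (1 / r) ≤ C :=
      (ENNReal.mul_le_mul_iff_left hne hnt).1 (hexp.symm.le.trans h3)
    calc I = (I ^ (1 / r)) ^ r := by
          rw [← ENNReal.rpow_mul, one_div, inv_mul_cancel₀ hr0.ne', ENNReal.rpow_one]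
      _ ≤ C ^ r := ENNReal.rpow_le_rpow h4 hr0.le
  have hlim : Filter.Tendsto (fun n => ∫⁻ x, T n x ^ r ∂μ) Filter.atTop
      (nhds (∫⁻ x, G x ^ r ∂μ)) := by
    refine lintegral_tendsto_of_tendsto_of_monotone (fun n => ((hTm n).pow_const _).aemeasurable)
      (Filter.Eventually.of_forall fun x n m hnm => ?_) (Filter.Eventually.of_forall fun x => ?_)
    · exact ENNReal.rpow_le_rpow (min_le_min_left _ (by exact_mod_cast hnm)) hr0.le
    · refine (ENNReal.continuous_rpow_const.tendsto _).comp ?_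
      have := (tendsto_const_nhds (x := G x)).min ENNReal.tendsto_nat_nhds_top
      simpa using this
  rw [eLpNorm_eq_lintegral_rpow_enorm_toReal hp0 hpt]
  simp only [enorm_eq_self]
  calc (∫⁻ x, G x ^ r ∂μ) ^ (1 / r) ≤ (C ^ r) ^ (1 / r) :=
        ENNReal.rpow_le_rpow (le_of_tendsto' hlim key) (by positivity)
    _ = C := by rw [← ENNReal.rpow_mul, one_div, mul_inv_cancel₀ hr0.ne', ENNReal.rpow_one]

/-- For a continuous function an essential bound on an interval is a pointwise bound. -/
theorem enorm_le_of_eLpNorm_top_le {E : Type*} [NormedAddCommGroup E] {g : ℝ → E}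
    (hg : Continuous g) {a b : ℝ} (hab : a < b) {C : ENNReal}
    (h : eLpNorm g ⊤ (volume.restrict (Ioc a b)) ≤ C) {x : ℝ} (hx : x ∈ Icc a b) :
    ‖g x‖ₑ ≤ C := by
  have hcl : IsClosed {x | ‖g x‖ₑ ≤ C} := isClosed_le hg.enorm continuous_const
  have hsub : Ioo a b ⊆ {x | ‖g x‖ₑ ≤ C} := by
    -- The points of the open interval where the bound fails form an open null set, hence an empty
    -- one; the endpoints follow by closure.
    have hO : IsOpen ({x | ‖g x‖ₑ ≤ C}ᶜ ∩ Ioo a b) := hcl.isOpen_compl.inter isOpen_Ioo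
    have h0 : volume ({x | ‖g x‖ₑ ≤ C}ᶜ ∩ Ioo a b) = 0 := by
      rw [eLpNorm_exponent_top] at h
      have h1 : ∀ᵐ x ∂(volume.restrict (Ioc a b)), ‖g x‖ₑ ≤ C :=
        (ae_le_eLpNormEssSup (f := g)).mono fun x hx => hx.trans h
      rw [ae_iff, Measure.restrict_apply' measurableSet_Ioc] at h1
      exact measure_mono_null (inter_subset_inter_right _ Ioo_subset_Ioc_self) h1
    have h1 := (hO.measure_eq_zero_iff volume).1 h0
    intro x hx
    by_contra hxn
    exact (h1 ▸ (⟨hxn, hx⟩ : x ∈ {x | ‖g x‖ₑ ≤ C}ᶜ ∩ Ioo a b) : x ∈ (∅ : Set ℝ))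
  have := closure_minimal hsub hcl
  rw [closure_Ioo hab.ne] at this
  exact this hx

/-! ### Majorants and their growth conditions -/

theorem IsMajorant.nonneg {ω : ℝ → ℝ} (h : IsMajorant ω) {t : ℝ} (ht : 0 ≤ t) : 0 ≤ ω t :=
  h.zero ▸ h.mono (mem_Ici.2 le_rfl) (mem_Ici.2 ht) ht

theorem IsMajorant.div_le_div {ω : ℝ → ℝ} (h : IsMajorant ω) {s t : ℝ} (hs : 0 < s)
    (hst : s ≤ t) : ω t / t ≤ ω s / s :=
  h.anti (mem_Ioi.2 hs) (mem_Ioi.2 (hs.trans_le hst)) hst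

/-- The growth condition of a slow majorant holds on all of `(0, 1]`. -/
theorem IsMajorant.exists_slow {ω : ℝ → ℝ} (h : IsMajorant ω) (hs : IsSlow ω) :
    ∃ M : ℝ, 0 < M ∧ ∀ δ : ℝ, 0 < δ → δ ≤ 1 →
      ∫⁻ t in Ioi δ, ENNReal.ofReal (ω t / t ^ 2) ≤ ENNReal.ofReal (M * (ω δ / δ)) := by
  obtain ⟨δ₀, hδ₀, M, hM, H⟩ := hs
  have small : ∀ δ, 0 < δ → δ < δ₀ →
      ∫⁻ t in Ioi δ, ENNReal.ofReal (ω t / t ^ 2) ≤ ENNReal.ofReal (M * (ω δ / δ)) := by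
    intro δ hδ hδ'
    obtain ⟨hi, hle⟩ := H δ hδ hδ'
    rw [← ofReal_integral_eq_lintegral_ofReal hi]
    · apply ENNReal.ofReal_le_ofReal
      rw [← mul_div_assoc, le_div_iff₀ hδ, mul_comm]
      exact hle
    · filter_upwards [ae_restrict_mem measurableSet_Ioi] with t ht
      exact div_nonneg (h.nonneg (hδ.trans ht).le) (sq_nonneg t)
  set δ₁ := min δ₀ 1 / 2 with hδ₁
  have hm : 0 < min δ₀ 1 := lt_min hδ₀ one_pos
  have h1 : 0 < δ₁ := by positivity
  have h2 : δ₁ < δ₀ := by have := min_le_left δ₀ 1; linarith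
  have h3 : δ₁ ≤ 1 := by have := min_le_right δ₀ 1; linarith
  -- Beyond δ₁ the tail only shrinks, while ω(δ₁) ≤ ω(δ) ≤ ω(δ)/δ because δ ≤ 1.
  refine ⟨M / δ₁, by positivity, fun δ hδ hδ1 => ?_⟩
  rcases lt_or_ge δ δ₁ with hlt | hge
  · refine (small δ hδ (hlt.trans h2)).trans (ENNReal.ofReal_le_ofReal ?_)
    have := h.nonneg hδ.le
    gcongr
    rw [le_div_iff₀ h1]; nlinarith
  · refine (lintegral_mono_set (Ioi_subset_Ioi hge)).trans
      ((small δ₁ h1 h2).trans (ENNReal.ofReal_le_ofReal ?_))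
    have e1 : ω δ₁ ≤ ω δ := h.mono h1.le hδ.le hge
    have e2 : ω δ ≤ ω δ / δ := by
      rw [le_div_iff₀ hδ]; nlinarith [h.nonneg hδ.le]
    rw [div_mul_eq_mul_div, ← mul_div_assoc]
    gcongr
    exact e1.trans e2

/-- The growth condition of a fast majorant holds on all of `(0, 1]`. -/
theorem IsMajorant.exists_fast {ω : ℝ → ℝ} (h : IsMajorant ω) (hs : IsFast ω) :
    ∃ M : ℝ, 0 < M ∧ ∀ δ : ℝ, 0 < δ → δ ≤ 1 →
      ∫⁻ t in Ioo 0 δ, ENNReal.ofReal (ω t / t) ≤ ENNReal.ofReal (M * ω δ) := by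
  obtain ⟨δ₀, hδ₀, M, hM, H⟩ := hs
  have small : ∀ δ, 0 < δ → δ < δ₀ →
      ∫⁻ t in Ioo 0 δ, ENNReal.ofReal (ω t / t) ≤ ENNReal.ofReal (M * ω δ) := by
    intro δ hδ hδ'
    obtain ⟨hi, hle⟩ := H δ hδ hδ'
    rw [← ofReal_integral_eq_lintegral_ofReal hi]
    · exact ENNReal.ofReal_le_ofReal hle
    · filter_upwards [ae_restrict_mem measurableSet_Ioo] with t ht
      exact div_nonneg (h.nonneg ht.1.le) ht.1.le
  set δ₁ := min δ₀ 1 / 2 with hδ₁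
  have hm : 0 < min δ₀ 1 := lt_min hδ₀ one_pos
  have h1 : 0 < δ₁ := by positivity
  have h2 : δ₁ < δ₀ := by have := min_le_left δ₀ 1; linarith
  -- The summand 1/δ₁ pays for [δ₁, δ): there ω(t)/t ≤ ω(δ₁)/δ₁ ≤ ω(δ)/δ₁, on a length at most 1.
  refine ⟨M + 1 / δ₁, by positivity, fun δ hδ hδ1 => ?_⟩
  have hn := h.nonneg hδ.le
  rcases lt_or_ge δ δ₁ with hlt | hge
  · refine (small δ hδ (hlt.trans h2)).trans (ENNReal.ofReal_le_ofReal ?_)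
    gcongr
    have : 0 < 1 / δ₁ := by positivity
    linarith
  · have hsub : Ioo 0 δ ⊆ Ioo 0 δ₁ ∪ Ico δ₁ δ := fun t ht => by
      rcases lt_or_ge t δ₁ with h | h
      · exact Or.inl ⟨ht.1, h⟩
      · exact Or.inr ⟨h, ht.2⟩
    have e1 : ω δ₁ ≤ ω δ := h.mono h1.le hδ.le hge
    have e2 : ∫⁻ t in Ico δ₁ δ, ENNReal.ofReal (ω t / t) ≤ ENNReal.ofReal (1 / δ₁ * ω δ) := by
      calc ∫⁻ t in Ico δ₁ δ, ENNReal.ofReal (ω t / t)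
          ≤ ∫⁻ _ in Ico δ₁ δ, ENNReal.ofReal (1 / δ₁ * ω δ) := by
            refine setLIntegral_mono measurable_const fun t ht => ENNReal.ofReal_le_ofReal ?_
            refine (h.div_le_div h1 ht.1).trans ?_
            rw [div_mul_eq_mul_div, one_mul]
            gcongr
        _ ≤ ENNReal.ofReal (1 / δ₁ * ω δ) * 1 := by
            rw [setLIntegral_const, Real.volume_Ico]
            gcongr
            rw [← ENNReal.ofReal_one]
            exact ENNReal.ofReal_le_ofReal (by linarith)
        _ = _ := mul_one _
    calc ∫⁻ t in Ioo 0 δ, ENNReal.ofReal (ω t / t)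
        ≤ ∫⁻ t in Ioo 0 δ₁ ∪ Ico δ₁ δ, ENNReal.ofReal (ω t / t) := lintegral_mono_set hsub
      _ ≤ _ := lintegral_union_le _ _ _
      _ ≤ ENNReal.ofReal (M * ω δ) + ENNReal.ofReal (1 / δ₁ * ω δ) := by
          refine add_le_add ((small δ₁ h1 h2).trans (ENNReal.ofReal_le_ofReal ?_)) e2
          gcongr
      _ = ENNReal.ofReal ((M + 1 / δ₁) * ω δ) := by
          rw [← ENNReal.ofReal_add (by positivity) (by positivity), add_mul]

/-! ### The weight dominating the Poisson kernel times a majorant -/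

/-- A bound for `ω |t|` times the Poisson kernel at distance `d` from the circle. -/
noncomputable def majorantWeight (ω : ℝ → ℝ) (d t : ℝ) : ℝ :=
  if |t| ≤ d then 2 / d * ω d else 2 * Real.pi ^ 2 * d * (ω |t| / |t| ^ 2)

theorem IsMajorant.measurable_comp_abs {ω : ℝ → ℝ} (h : IsMajorant ω) :
    Measurable fun t : ℝ => ω |t| :=
  (h.continuousOn.comp_continuous continuous_abs fun t => abs_nonneg t).measurable

theorem IsMajorant.measurable_majorantWeight {ω : ℝ → ℝ} (h : IsMajorant ω) (d : ℝ) :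
    Measurable (majorantWeight ω d) :=
  Measurable.ite (measurableSet_le continuous_abs.measurable measurable_const) measurable_const
    ((h.measurable_comp_abs.div (continuous_abs.measurable.pow_const 2)).const_mul _)

/-- The plateau |t| ≤ d contributes 4ω(d). Each of the two tails is 2π²d times the integral in the
slow condition, hence at most 2π²M ω(d). -/
theorem IsMajorant.exists_lintegral_majorantWeight_le {ω : ℝ → ℝ} (h : IsMajorant ω)
    (hs : IsSlow ω) : ∃ C : ℝ, 0 < C ∧ ∀ d : ℝ, 0 < d → d ≤ 1 →
      ∫⁻ t, ENNReal.ofReal (majorantWeight ω d t) ≤ ENNReal.ofReal (C * ω d) := by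
  obtain ⟨M, hM, H⟩ := h.exists_slow hs
  refine ⟨4 + 2 * (2 * Real.pi ^ 2 * M), by positivity, fun d hd hd1 => ?_⟩
  have hn := h.nonneg hd.le
  have hout : ∫⁻ t in Ioi d, ENNReal.ofReal (majorantWeight ω d t) ≤
      ENNReal.ofReal (2 * Real.pi ^ 2 * M * ω d) := by
    calc ∫⁻ t in Ioi d, ENNReal.ofReal (majorantWeight ω d t)
        = ∫⁻ t in Ioi d, ENNReal.ofReal (2 * Real.pi ^ 2 * d) * ENNReal.ofReal (ω t / t ^ 2) := by
          refine setLIntegral_congr_fun measurableSet_Ioi fun t ht => ?_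
          have ht0 : 0 < t := hd.trans ht
          simp only [majorantWeight, abs_of_pos ht0, not_le.2 (mem_Ioi.1 ht), if_false]
          rw [ENNReal.ofReal_mul (by positivity)]
      _ = ENNReal.ofReal (2 * Real.pi ^ 2 * d) *
            ∫⁻ t in Ioi d, ENNReal.ofReal (ω t / t ^ 2) :=
          lintegral_const_mul' _ _ ENNReal.ofReal_ne_top
      _ ≤ ENNReal.ofReal (2 * Real.pi ^ 2 * d) * ENNReal.ofReal (M * (ω d / d)) := by
          gcongr; exact H d hd hd1
      _ = ENNReal.ofReal (2 * Real.pi ^ 2 * M * ω d) := by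
          rw [← ENNReal.ofReal_mul (by positivity)]
          congr 1; field_simp
  have hneg : ∫⁻ t in Iio (-d), ENNReal.ofReal (majorantWeight ω d t) =
      ∫⁻ t in Ioi d, ENNReal.ofReal (majorantWeight ω d t) := by
    have := (Measure.measurePreserving_neg (volume : Measure ℝ)).setLIntegral_comp_preimage_emb
      (MeasurableEquiv.neg ℝ).measurableEmbedding
      (fun t => ENNReal.ofReal (majorantWeight ω d t)) (Ioi d)
    rw [← this]
    have e : (Neg.neg ⁻¹' Ioi d : Set ℝ) = Iio (-d) := by ext t; simp
    rw [e]
    simp [majorantWeight]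
  have hin : ∫⁻ t in Icc (-d) d, ENNReal.ofReal (majorantWeight ω d t) ≤
      ENNReal.ofReal (4 * ω d) := by
    calc ∫⁻ t in Icc (-d) d, ENNReal.ofReal (majorantWeight ω d t)
        = ∫⁻ _ in Icc (-d) d, ENNReal.ofReal (2 / d * ω d) := by
          refine setLIntegral_congr_fun measurableSet_Icc fun t ht => ?_
          simp only [majorantWeight, abs_le.2 ht, if_true]
      _ = ENNReal.ofReal (4 * ω d) := by
          rw [setLIntegral_const, Real.volume_Icc, ← ENNReal.ofReal_mul (by positivity)]
          congr 1; field_simp; ring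
      _ ≤ _ := le_rfl
  have hcov : (univ : Set ℝ) ⊆ Icc (-d) d ∪ (Ioi d ∪ Iio (-d)) := fun t _ => by
    simp only [mem_union, mem_Icc, mem_Ioi, mem_Iio]
    by_contra! hc
    obtain ⟨h1, h2, h3⟩ := hc
    exact absurd (h1 h3) (not_lt.2 h2)
  calc ∫⁻ t, ENNReal.ofReal (majorantWeight ω d t)
      = ∫⁻ t in univ, ENNReal.ofReal (majorantWeight ω d t) := by simp
    _ ≤ ∫⁻ t in Icc (-d) d ∪ (Ioi d ∪ Iio (-d)), ENNReal.ofReal (majorantWeight ω d t) :=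
        lintegral_mono_set hcov
    _ ≤ ENNReal.ofReal (4 * ω d) + (ENNReal.ofReal (2 * Real.pi ^ 2 * M * ω d) +
          ENNReal.ofReal (2 * Real.pi ^ 2 * M * ω d)) := by
        refine (lintegral_union_le _ _ _).trans (add_le_add hin ?_)
        exact (lintegral_union_le _ _ _).trans (add_le_add hout (hneg ▸ hout))
    _ = ENNReal.ofReal ((4 + 2 * (2 * Real.pi ^ 2 * M)) * ω d) := by
        rw [← ENNReal.ofReal_add (by positivity) (by positivity),
          ← ENNReal.ofReal_add (by positivity) (by positivity)]
        congr 1; ring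

/-! ### Poisson kernels and Poisson integrals of continuous functions -/

theorem poissonKernel_zero_of_norm_eq_one {z ζ : ℂ} (hζ : ‖ζ‖ = 1) :
    poissonKernel 0 z ζ = (1 - ‖z‖ ^ 2) / ‖ζ - z‖ ^ 2 := by
  simp [poissonKernel_def, hζ]

theorem poissonKernel_nonneg_of_norm_eq_one {z ζ : ℂ} (hz : ‖z‖ < 1) (hζ : ‖ζ‖ = 1) :
    0 ≤ poissonKernel 0 z ζ := by
  rw [poissonKernel_zero_of_norm_eq_one hζ]
  have : 0 ≤ 1 - ‖z‖ ^ 2 := by nlinarith [norm_nonneg z]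
  positivity

theorem one_sub_norm_le_norm_sub {z ζ : ℂ} (hζ : ‖ζ‖ = 1) : 1 - ‖z‖ ≤ ‖ζ - z‖ :=
  hζ ▸ norm_sub_norm_le ζ z

theorem continuousOn_poissonKernel {z : ℂ} (hz : ‖z‖ < 1) :
    ContinuousOn (poissonKernel 0 z) (Metric.sphere 0 1) := by
  have h : ∀ ζ ∈ Metric.sphere (0 : ℂ) 1, ‖ζ - z‖ ^ 2 ≠ 0 := fun ζ hζ => by
    have := one_sub_norm_le_norm_sub (z := z) (mem_sphere_zero_iff_norm.1 hζ)
    have : 0 < ‖ζ - z‖ := by linarith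
    positivity
  have : ContinuousOn (fun ζ : ℂ => (1 - ‖z‖ ^ 2) / ‖ζ - z‖ ^ 2) (Metric.sphere 0 1) :=
    continuousOn_const.div (by fun_prop) h
  exact this.congr fun ζ hζ => poissonKernel_zero_of_norm_eq_one (mem_sphere_zero_iff_norm.1 hζ)

theorem circleIntegrable_mul_poissonKernel {φ : ℂ → ℝ} (hφ : ContinuousOn φ (Metric.sphere 0 1))
    {z : ℂ} (hz : ‖z‖ < 1) : CircleIntegrable (fun ζ => φ ζ * poissonKernel 0 z ζ) 0 1 :=
  (hφ.mul (continuousOn_poissonKernel hz)).circleIntegrable zero_le_one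

theorem InnerProductSpace.HarmonicContOnCl.poissonInt_eq {u : ℂ → ℝ}
    (hu : InnerProductSpace.HarmonicContOnCl u unitDisk) {z : ℂ} (hz : ‖z‖ < 1) :
    poissonInt u z = u z := by
  rw [← hu.circleAverage_poissonKernel_smul (mem_ball_zero_iff.2 hz), poissonInt]
  congr 1
  ext ζ
  simp [mul_comm]

theorem poissonInt_const (c : ℝ) {z : ℂ} (hz : ‖z‖ < 1) : poissonInt (fun _ => c) z = c :=
  InnerProductSpace.HarmonicContOnCl.poissonInt_eq
    InnerProductSpace.harmonicContOnCl_const hz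

theorem poissonInt_mono {φ ψ : ℂ → ℝ} (hφ : ContinuousOn φ (Metric.sphere 0 1))
    (hψ : ContinuousOn ψ (Metric.sphere 0 1)) {z : ℂ} (hz : ‖z‖ < 1)
    (h : ∀ ζ ∈ Metric.sphere (0 : ℂ) 1, φ ζ ≤ ψ ζ) : poissonInt φ z ≤ poissonInt ψ z := by
  refine Real.circleAverage_mono (circleIntegrable_mul_poissonKernel hφ hz)
    (circleIntegrable_mul_poissonKernel hψ hz) fun ζ hζ => ?_
  rw [abs_one] at hζ
  exact mul_le_mul_of_nonneg_right (h ζ hζ)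
    (poissonKernel_nonneg_of_norm_eq_one hz (mem_sphere_zero_iff_norm.1 hζ))

theorem poissonInt_add {φ ψ : ℂ → ℝ} (hφ : ContinuousOn φ (Metric.sphere 0 1))
    (hψ : ContinuousOn ψ (Metric.sphere 0 1)) {z : ℂ} (hz : ‖z‖ < 1) :
    poissonInt (fun ζ => φ ζ + ψ ζ) z = poissonInt φ z + poissonInt ψ z := by
  simp only [poissonInt, add_mul]
  exact Real.circleAverage_fun_add (circleIntegrable_mul_poissonKernel hφ hz)
    (circleIntegrable_mul_poissonKernel hψ hz)

theorem poissonInt_sub {φ ψ : ℂ → ℝ} (hφ : ContinuousOn φ (Metric.sphere 0 1))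
    (hψ : ContinuousOn ψ (Metric.sphere 0 1)) {z : ℂ} (hz : ‖z‖ < 1) :
    poissonInt (fun ζ => φ ζ - ψ ζ) z = poissonInt φ z - poissonInt ψ z := by
  simp only [poissonInt, sub_mul]
  exact Real.circleAverage_fun_sub (circleIntegrable_mul_poissonKernel hφ hz)
    (circleIntegrable_mul_poissonKernel hψ hz)

/-- A Harnack-type bound for differences of the Poisson kernel. -/
theorem abs_poissonKernel_sub_le {z z' ζ : ℂ} (hz : ‖z‖ < 1) (hζ : ‖ζ‖ = 1)
    (hz' : ‖z' - z‖ ≤ (1 - ‖z‖) / 2) :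
    |poissonKernel 0 z' ζ - poissonKernel 0 z ζ| ≤
      4 * ‖z' - z‖ / (1 - ‖z‖) * poissonKernel 0 z ζ := by
  have hd : 0 < 1 - ‖z‖ := by linarith
  have h1 : 1 - ‖z‖ ≤ ‖ζ - z‖ := one_sub_norm_le_norm_sub hζ
  have h1' : 0 < ‖ζ - z‖ := hd.trans_le h1
  -- Moving z by at most half its distance to the circle costs a factor 2, which turns the 2 of the
  -- identity below into 4.
  have h2 : ‖ζ - z‖ / 2 ≤ ‖ζ - z'‖ := by
    have : ‖ζ - z‖ ≤ ‖ζ - z'‖ + ‖z' - z‖ := by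
      simpa using norm_add_le (ζ - z') (z' - z)
    linarith
  have h2' : 0 < ‖ζ - z'‖ := by linarith
  -- The Poisson kernel is the real part of (ζ + z)/(ζ - z), whose differences factor exactly.
  have e : (ζ + z') / (ζ - z') - (ζ + z) / (ζ - z) =
      2 * ζ * (z' - z) / ((ζ - z') * (ζ - z)) := by
    have a1 : ζ - z ≠ 0 := norm_pos_iff.1 h1'
    have a2 : ζ - z' ≠ 0 := norm_pos_iff.1 h2'
    field_simp
    ring
  have h3 : |poissonKernel 0 z' ζ - poissonKernel 0 z ζ| ≤
      2 * ‖z' - z‖ / (‖ζ - z'‖ * ‖ζ - z‖) := by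
    simp only [poissonKernel_eq_re_herglotzRieszKernel, Function.comp_apply,
      herglotzRieszKernel_def, sub_zero]
    rw [← Complex.sub_re, e]
    refine (Complex.abs_re_le_norm _).trans ?_
    simp [hζ]
  refine h3.trans ?_
  rw [poissonKernel_zero_of_norm_eq_one hζ]
  have h4 : 1 - ‖z‖ ≤ 1 - ‖z‖ ^ 2 := by nlinarith [norm_nonneg z]
  calc 2 * ‖z' - z‖ / (‖ζ - z'‖ * ‖ζ - z‖)
      ≤ 2 * ‖z' - z‖ / (‖ζ - z‖ / 2 * ‖ζ - z‖) := by gcongr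
    _ = 4 * ‖z' - z‖ / (1 - ‖z‖) * ((1 - ‖z‖) / ‖ζ - z‖ ^ 2) := by field_simp; ring
    _ ≤ _ := by gcongr

/-- Poisson integrals reproduce constants, so φ may be replaced by φ - c before the kernel estimate
is integrated. Leaving c free allows a boundary value to be subtracted later, which yields an
oscillation. -/
theorem abs_poissonInt_sub_le {φ : ℂ → ℝ} (hφ : ContinuousOn φ (Metric.sphere 0 1)) (c : ℝ)
    {z z' : ℂ} (hz : ‖z‖ < 1) (hz' : ‖z' - z‖ ≤ (1 - ‖z‖) / 2) :
    |poissonInt φ z' - poissonInt φ z| ≤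
      4 * ‖z' - z‖ / (1 - ‖z‖) * poissonInt (fun ζ => |φ ζ - c|) z := by
  have hz1 : ‖z'‖ < 1 := by
    have : ‖z'‖ ≤ ‖z' - z‖ + ‖z‖ := by simpa using norm_add_le (z' - z) z
    linarith
  have hφc : ContinuousOn (fun ζ => φ ζ - c) (Metric.sphere 0 1) := hφ.sub continuousOn_const
  have e : ∀ {w : ℂ}, ‖w‖ < 1 → poissonInt φ w = poissonInt (fun ζ => φ ζ - c) w + c :=
    fun {w} hw => by
      rw [poissonInt_sub hφ continuousOn_const hw, poissonInt_const c hw]; ring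
  rw [e hz, e hz1, add_sub_add_right_eq_sub]
  simp only [poissonInt]
  rw [← Real.circleAverage_fun_sub (circleIntegrable_mul_poissonKernel hφc hz1)
    (circleIntegrable_mul_poissonKernel hφc hz)]
  refine Real.abs_circleAverage_le_circleAverage_abs.trans ?_
  rw [← smul_eq_mul, ← Real.circleAverage_fun_smul]
  refine Real.circleAverage_mono ?_ ?_ fun ζ hζ => ?_
  · exact (((hφc.mul (continuousOn_poissonKernel hz1)).sub
      (hφc.mul (continuousOn_poissonKernel hz))).abs).circleIntegrable zero_le_one
  · exact ((continuousOn_const (c := 4 * ‖z' - z‖ / (1 - ‖z‖))).mul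
      (hφc.abs.mul (continuousOn_poissonKernel hz))).circleIntegrable zero_le_one
  · rw [abs_one, mem_sphere_zero_iff_norm] at hζ
    have := abs_poissonKernel_sub_le hz hζ hz'
    simp only [Pi.abs_apply, smul_eq_mul]
    rw [← mul_sub, abs_mul, mul_left_comm]
    gcongr

theorem continuousOn_poissonInt {φ : ℂ → ℝ} (hφ : ContinuousOn φ (Metric.sphere 0 1)) :
    ContinuousOn (poissonInt φ) unitDisk := by
  intro z hz
  have hz1 : ‖z‖ < 1 := mem_ball_zero_iff.1 hz
  refine ContinuousAt.continuousWithinAt ?_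
  rw [ContinuousAt, tendsto_iff_norm_sub_tendsto_zero]
  have hlim : Filter.Tendsto (fun z' => 4 * ‖z' - z‖ / (1 - ‖z‖) *
      poissonInt (fun ζ => |φ ζ - 0|) z) (nhds z) (nhds 0) := by
    have : Continuous fun z' => 4 * ‖z' - z‖ / (1 - ‖z‖) * poissonInt (fun ζ => |φ ζ - 0|) z := by
      fun_prop
    simpa using this.tendsto z
  refine squeeze_zero' (Filter.Eventually.of_forall fun _ => norm_nonneg _) ?_ hlim
  filter_upwards [Metric.closedBall_mem_nhds z (show 0 < (1 - ‖z‖) / 2 by linarith)] with z' hz'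
  exact abs_poissonInt_sub_le hφ 0 hz1 (by simpa [dist_eq_norm] using hz')

/-! ### Poisson means of oscillations in L^p -/

theorem two_mul_abs_div_pi_le_norm_exp_sub_one {t : ℝ} (ht : |t| ≤ Real.pi) :
    2 * |t| / Real.pi ≤ ‖Complex.exp (t * Complex.I) - 1‖ := by
  rw [mul_comm (t : ℂ), Complex.norm_exp_I_mul_ofReal_sub_one, Real.norm_eq_abs, abs_mul, abs_two]
  have := Real.mul_abs_le_abs_sin (x := t / 2) (by rw [abs_div, abs_two]; linarith)
  rw [abs_div, abs_two] at this
  calc 2 * |t| / Real.pi = 2 * (2 / Real.pi * (|t| / 2)) := by ring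
    _ ≤ _ := by gcongr

theorem norm_exp_mul_I_sub_one_le (t : ℝ) : ‖Complex.exp (t * Complex.I) - 1‖ ≤ |t| := by
  rw [mul_comm (t : ℂ)]
  exact Real.norm_exp_I_mul_ofReal_sub_one_le

/-- With d = 1 - r, the distance |e^{it} - r| is at least d and at least |t|/π. The first bound
makes the kernel at most 2/d, the second at most 2π²d/t²; these are the two branches of the weight.
-/
theorem poissonKernel_mul_le_majorantWeight {ω : ℝ → ℝ} (h : IsMajorant ω) {r t : ℝ} (hr : 0 ≤ r)
    (hr1 : r < 1) (ht : |t| ≤ Real.pi) :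
    poissonKernel 0 r (Complex.exp (t * Complex.I)) * ω ‖Complex.exp (t * Complex.I) - 1‖ ≤
      majorantWeight ω (1 - r) t := by
  have hζ : ‖Complex.exp (t * Complex.I)‖ = 1 := Complex.norm_exp_ofReal_mul_I t
  have hrn : ‖(r : ℂ)‖ = r := by simp [abs_of_nonneg hr]
  have hP := poissonKernel_nonneg_of_norm_eq_one (z := r) (by rwa [hrn]) hζ
  have hω : ω ‖Complex.exp (t * Complex.I) - 1‖ ≤ ω |t| :=
    h.mono (mem_Ici.2 (norm_nonneg _)) (mem_Ici.2 (abs_nonneg _)) (norm_exp_mul_I_sub_one_le t)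
  have hωt := h.nonneg (abs_nonneg t)
  refine (mul_le_mul_of_nonneg_left hω hP).trans ?_
  have hd : 0 < 1 - r := by linarith
  have h1 : 1 - r ≤ ‖Complex.exp (t * Complex.I) - r‖ := by
    have := one_sub_norm_le_norm_sub (z := r) hζ
    rwa [hrn] at this
  -- By Jordan's inequality 2|t|/π ≤ |e^{it} - 1| ≤ |e^{it} - r| + (1 - r), and 1 - r ≤ |e^{it} -
  -- r|.
  have h2 : |t| / Real.pi ≤ ‖Complex.exp (t * Complex.I) - r‖ := by
    have a := two_mul_abs_div_pi_le_norm_exp_sub_one ht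
    have b : ‖Complex.exp (t * Complex.I) - 1‖ ≤ ‖Complex.exp (t * Complex.I) - r‖ + (1 - r) := by
      have := norm_add_le (Complex.exp (t * Complex.I) - r) ((r : ℂ) - 1)
      have e : ‖(r : ℂ) - 1‖ = 1 - r := by
        rw [← Complex.ofReal_one, ← Complex.ofReal_sub, Complex.norm_real, Real.norm_eq_abs,
          abs_sub_comm, abs_of_pos hd]
      rwa [e, sub_add_sub_cancel] at this
    have : 2 * |t| / Real.pi = 2 * (|t| / Real.pi) := by ring
    linarith
  rw [poissonKernel_zero_of_norm_eq_one hζ, hrn]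
  have h3 : 1 - r ^ 2 ≤ 2 * (1 - r) := by nlinarith
  have h4 : 0 ≤ 1 - r ^ 2 := by nlinarith
  unfold majorantWeight
  split_ifs with hc
  · have : ω |t| ≤ ω (1 - r) :=
      h.mono (mem_Ici.2 (abs_nonneg t)) (mem_Ici.2 hd.le) hc
    calc (1 - r ^ 2) / ‖Complex.exp (t * Complex.I) - r‖ ^ 2 * ω |t|
        ≤ 2 * (1 - r) / (1 - r) ^ 2 * ω (1 - r) := by gcongr
      _ = _ := by field_simp
  · have ht0 : 0 < |t| := hd.trans (not_le.1 hc)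
    have := Real.pi_pos
    calc (1 - r ^ 2) / ‖Complex.exp (t * Complex.I) - r‖ ^ 2 * ω |t|
        ≤ 2 * (1 - r) / (|t| / Real.pi) ^ 2 * ω |t| := by gcongr
      _ = _ := by field_simp

/-- The `L^p(0, 2π)` norm of `η ↦ f (e^{iη} z₁) - f (e^{iη} z₂)`. -/
noncomputable def rotNorm {E : Type*} [NormedAddCommGroup E] (p : ENNReal) (f : ℂ → E) (z₁ z₂ : ℂ) : ENNReal :=
  eLpNorm (fun η : ℝ => f (Complex.exp (η * Complex.I) * z₁) -
    f (Complex.exp (η * Complex.I) * z₂)) p (volume.restrict (Ioc 0 (2 * Real.pi)))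

theorem exists_exp_mul_I_eq {ξ : ℂ} (hξ : ‖ξ‖ = 1) : ∃ β : ℝ, Complex.exp (β * Complex.I) = ξ :=
  ⟨ξ.arg, by simpa [hξ] using Complex.norm_mul_exp_arg_mul_I ξ⟩

theorem norm_exp_mul_I_mul (η : ℝ) (z : ℂ) : ‖Complex.exp (η * Complex.I) * z‖ = ‖z‖ := by
  rw [norm_mul, Complex.norm_exp_ofReal_mul_I, one_mul]

theorem poissonKernel_mul_mul {z ζ ξ : ℂ} (hξ : ‖ξ‖ = 1) :
    poissonKernel 0 (z * ξ) (ζ * ξ) = poissonKernel 0 z ζ := by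
  simp only [poissonKernel_def, sub_zero, ← sub_mul, norm_mul, hξ, mul_one]

/-- Rotation invariance of the kernel moves ξ into the argument of ψ. The kernel then depends on t
alone, as needed to apply Minkowski over rotations of ξ. The factor 1/(2π) is bounded by 1. -/
theorem enorm_poissonInt_le (ψ : ℂ → ℝ) (z : ℂ) {ξ : ℂ} (hξ : ‖ξ‖ = 1) :
    ‖poissonInt ψ (z * ξ)‖ₑ ≤ ∫⁻ t in Ioc (-Real.pi) Real.pi,
      ‖ψ (Complex.exp ((t : ℝ) * Complex.I) * ξ) *
        poissonKernel 0 z (Complex.exp (t * Complex.I))‖ₑ := by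
  obtain ⟨β, rfl⟩ := exists_exp_mul_I_eq hξ
  have hpi := Real.pi_pos
  set H : ℝ → ℝ := fun t => ψ (Complex.exp (t * Complex.I) * Complex.exp (β * Complex.I)) *
        poissonKernel 0 z (Complex.exp (t * Complex.I)) with hH
  have e : poissonInt ψ (z * Complex.exp (β * Complex.I)) =
      (2 * Real.pi)⁻¹ • ∫ t in Ioc (-Real.pi) Real.pi, H t := by
    rw [poissonInt, Real.circleAverage_eq_integral_add (β - Real.pi)]
    have e1 : ∀ θ : ℝ, circleMap 0 1 (θ + (β - Real.pi)) =
        Complex.exp ((θ - Real.pi : ℝ) * Complex.I) * Complex.exp (β * Complex.I) := fun θ => by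
      rw [circleMap, ← Complex.exp_add]
      simp only [Complex.ofReal_one, one_mul, zero_add]
      congr 1
      push_cast
      ring
    simp only [e1, poissonKernel_mul_mul hξ]
    congr 1
    rw [← intervalIntegral.integral_of_le (by linarith),
      intervalIntegral.integral_comp_sub_right H Real.pi]
    congr 1 <;> ring
  rw [e, enorm_smul]
  have h1 : ‖(2 * Real.pi)⁻¹‖ₑ ≤ 1 := by
    rw [Real.enorm_eq_ofReal (by positivity), ← ENNReal.ofReal_one]
    refine ENNReal.ofReal_le_ofReal (inv_le_one_of_one_le₀ ?_)
    linarith [Real.pi_gt_three]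
  calc _ ≤ 1 * ∫⁻ t in Ioc (-Real.pi) Real.pi, ‖H t‖ₑ :=
        mul_le_mul' h1 (enorm_integral_le_lintegral_enorm _)
    _ = _ := one_mul _

/-- The mean oscillation `P[‖φ - φ(ξ)‖](rξ)` inherits the `L^p` smoothness of `φ`. -/
theorem eLpNorm_poissonInt_norm_sub_le {E : Type*} [NormedAddCommGroup E] [NormedSpace ℝ E]
    {p : ENNReal} (hp : 1 ≤ p) {ω : ℝ → ℝ} (h : IsMajorant ω) {C M : ℝ} (hM : 0 ≤ M)
    (hC : ∀ d : ℝ, 0 < d → d ≤ 1 →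
      ∫⁻ t, ENNReal.ofReal (majorantWeight ω d t) ≤ ENNReal.ofReal (C * ω d))
    {φ : ℂ → E} (hφ : ContinuousOn φ (Metric.sphere 0 1))
    (hφM : ∀ ξ₁ ∈ Metric.sphere (0 : ℂ) 1, ∀ ξ₂ ∈ Metric.sphere (0 : ℂ) 1,
      rotNorm p φ ξ₁ ξ₂ ≤ ENNReal.ofReal (M * ω ‖ξ₁ - ξ₂‖))
    {r : ℝ} (hr : 0 ≤ r) (hr1 : r < 1) {ξ : ℂ} (hξ : ‖ξ‖ = 1) :
    eLpNorm (fun η : ℝ => poissonInt (fun ζ => ‖φ ζ - φ (Complex.exp (η * Complex.I) * ξ)‖)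
      (r * (Complex.exp (η * Complex.I) * ξ))) p (volume.restrict (Ioc 0 (2 * Real.pi))) ≤
      ENNReal.ofReal (M * (C * ω (1 - r))) := by
  set U : ℝ → ℂ := fun η => Complex.exp (η * Complex.I) with hU
  have hUc : Continuous U := by fun_prop
  have hU1 : ∀ η, ‖U η‖ = 1 := fun η => Complex.norm_exp_ofReal_mul_I η
  have hrn : ‖(r : ℂ)‖ < 1 := by simpa [abs_of_nonneg hr] using hr1
  -- For fixed t, the L^p norm in η is the kernel times `rotNorm` of φ at e^{it}ξ and ξ, two points
  -- at distance |e^{it} - 1|.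
  set F : ℝ → ℝ → ENNReal := fun η t =>
    ‖poissonKernel 0 r (U t) • (φ (U t * (U η * ξ)) - φ (U η * ξ))‖ₑ with hF
  have hFm : Measurable (Function.uncurry F) := by
    refine Continuous.measurable (Continuous.enorm (Continuous.smul ?_ (Continuous.sub ?_ ?_)))
    · exact (continuousOn_poissonKernel hrn).comp_continuous (hUc.comp continuous_snd)
        fun x => by simp [hU1]
    · exact hφ.comp_continuous (by fun_prop) fun x => by simp [hU1, hξ]
    · exact hφ.comp_continuous (by fun_prop) fun x => by simp [hU1, hξ]
  have hbound : ∀ᵐ t ∂(volume.restrict (Ioc (-Real.pi) Real.pi)),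
      eLpNorm (fun η => F η t) p (volume.restrict (Ioc 0 (2 * Real.pi))) ≤
        ENNReal.ofReal M * ENNReal.ofReal (majorantWeight ω (1 - r) t) := by
    filter_upwards [ae_restrict_mem measurableSet_Ioc] with t ht
    have e1 : eLpNorm (fun η => F η t) p (volume.restrict (Ioc 0 (2 * Real.pi))) =
        ‖poissonKernel 0 r (U t)‖ₑ * rotNorm p φ (U t * ξ) ξ := by
      rw [rotNorm, ← eLpNorm_const_smul]
      simp only [hF]
      rw [eLpNorm_enorm]
      simp only [hU]
      congr 1
      ext η
      simp only [Pi.smul_apply, mul_left_comm]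
    have e2 : ‖U t * ξ - ξ‖ = ‖U t - 1‖ := by
      rw [← sub_one_mul, norm_mul, hξ, mul_one]
    have hP := poissonKernel_nonneg_of_norm_eq_one hrn (hU1 t)
    have ht' : |t| ≤ Real.pi := abs_le.2 ⟨ht.1.le, ht.2⟩
    rw [e1, Real.enorm_eq_ofReal hP]
    calc _ ≤ ENNReal.ofReal (poissonKernel 0 r (U t)) * ENNReal.ofReal (M * ω ‖U t * ξ - ξ‖) := by
          gcongr
          exact hφM _ (by simp [hU1, hξ]) _ (by simp [hξ])
      _ = ENNReal.ofReal M * ENNReal.ofReal (poissonKernel 0 r (U t) * ω ‖U t - 1‖) := by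
          rw [e2, ← ENNReal.ofReal_mul hP, ← ENNReal.ofReal_mul hM, mul_left_comm]
      _ ≤ _ := by
          gcongr
          exact poissonKernel_mul_le_majorantWeight h hr hr1 ht'
  calc _ ≤ eLpNorm (fun η => ∫⁻ t in Ioc (-Real.pi) Real.pi, F η t) p
        (volume.restrict (Ioc 0 (2 * Real.pi))) := by
        refine eLpNorm_mono_enorm fun η => ?_
        refine (enorm_poissonInt_le _ _ (by simp [hξ])).trans ?_
        rw [enorm_eq_self]
        refine lintegral_mono fun t => ?_
        simp only [hF, enorm_smul, enorm_mul, enorm_norm]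
        rw [mul_comm]
    _ ≤ ∫⁻ t in Ioc (-Real.pi) Real.pi,
        ENNReal.ofReal M * ENNReal.ofReal (majorantWeight ω (1 - r) t) :=
        eLpNorm_lintegral_le hp hFm
          ((h.measurable_majorantWeight _).ennreal_ofReal.const_mul _).aemeasurable hbound
    _ ≤ ENNReal.ofReal M * ∫⁻ t, ENNReal.ofReal (majorantWeight ω (1 - r) t) := by
        rw [lintegral_const_mul _ (h.measurable_majorantWeight _).ennreal_ofReal]
        gcongr
        exact Measure.restrict_le_self
    _ ≤ ENNReal.ofReal M * ENNReal.ofReal (C * ω (1 - r)) := by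
        gcongr
        exact hC _ (by linarith) (by linarith)
    _ = _ := (ENNReal.ofReal_mul hM).symm

/-! ### Stretch, quasiregularity and gradient bounds -/

theorem fderiv_apply_eq_dz_mul_add {f : ℂ → ℂ} {z : ℂ} (hf : DifferentiableAt ℝ f z) (v : ℂ) :
    fderiv ℝ f z v = dz f z * v + dzbar f z * (starRingEnd ℂ) v := by
  have hv : v = v.re • (1 : ℂ) + v.im • Complex.I := by
    simp [Complex.re_add_im]
  have e : fderiv ℝ f z v = v.re * fderiv ℝ f z 1 + v.im * fderiv ℝ f z Complex.I := by
    conv_lhs => rw [hv]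
    rw [map_add, map_smul, map_smul, Complex.real_smul, Complex.real_smul]
  have h1 : (starRingEnd ℂ) v = v.re - v.im * Complex.I := by
    apply Complex.ext <;> simp
  rw [e, dz, dzbar, hf.lineDeriv_eq_fderiv, hf.lineDeriv_eq_fderiv, h1]
  conv_rhs => rw [← Complex.re_add_im v]
  simp only [Complex.add_re, Complex.add_im, Complex.ofReal_re, Complex.ofReal_im, Complex.mul_re,
    Complex.mul_im, Complex.I_re, Complex.I_im, mul_zero, mul_one, add_zero, zero_add, sub_zero]
  linear_combination ((v.im : ℂ) * fderiv ℝ f z Complex.I) * Complex.I_mul_I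

theorem norm_fderiv_le_maxStretch {f : ℂ → ℂ} {z : ℂ} (hf : DifferentiableAt ℝ f z) :
    ‖fderiv ℝ f z‖ ≤ maxStretch f z := by
  refine ContinuousLinearMap.opNorm_le_bound _ (add_nonneg (norm_nonneg _) (norm_nonneg _))
    fun v => ?_
  rw [fderiv_apply_eq_dz_mul_add hf]
  refine (norm_add_le _ _).trans ?_
  rw [norm_mul, norm_mul, RCLike.norm_conj, maxStretch, add_mul]

/-- The gradient of `Re (l f)` is at least the minimal stretch of `f`. -/
theorem norm_dz_sub_norm_dzbar_le {f : ℂ → ℂ} {z l : ℂ} (hf : DifferentiableAt ℝ f z)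
    (hl : ‖l‖ = 1) : ‖dz f z‖ - ‖dzbar f z‖ ≤ ‖fderiv ℝ (fun w => (l * f w).re) z‖ := by
  -- The differential of Re(l f) is v ↦ Re(w v), so the conjugate of w is its gradient and the right
  -- direction to test.
  set w := l * dz f z + (starRingEnd ℂ) (l * dzbar f z) with hw
  have h1 : ‖dz f z‖ - ‖dzbar f z‖ ≤ ‖w‖ := by
    have := norm_sub_le_norm_add (l * dz f z) ((starRingEnd ℂ) (l * dzbar f z))
    rwa [RCLike.norm_conj, norm_mul, norm_mul, hl, one_mul, one_mul] at this
  refine h1.trans ?_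
  have hD : fderiv ℝ (fun w => (l * f w).re) z ((starRingEnd ℂ) w) = ‖w‖ ^ 2 := by
    have hd : HasFDerivAt (fun w => (l * f w).re) (Complex.reCLM.comp (l • fderiv ℝ f z)) z :=
      Complex.reCLM.hasFDerivAt.comp z (hf.hasFDerivAt.const_mul l)
    rw [hd.fderiv]
    simp only [ContinuousLinearMap.comp_apply, smul_apply, smul_eq_mul,
      Complex.reCLM_apply, fderiv_apply_eq_dz_mul_add hf, Complex.conj_conj]
    rw [← Complex.normSq_eq_norm_sq, Complex.normSq_apply, hw]
    simp only [Complex.mul_re, Complex.add_re, Complex.add_im, Complex.mul_im, Complex.conj_re,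
      Complex.conj_im]
    ring
  have h2 := (fderiv ℝ (fun w => (l * f w).re) z).le_opNorm ((starRingEnd ℂ) w)
  rw [hD, RCLike.norm_conj, Real.norm_eq_abs, abs_of_nonneg (sq_nonneg _)] at h2
  rcases (norm_nonneg w).eq_or_lt with h0 | h0
  · rw [← h0]; exact norm_nonneg _
  · rw [sq] at h2
    exact le_of_mul_le_mul_right h2 h0

theorem InnerProductSpace.HarmonicContOnCl.continuousAt_fderiv {f : ℂ → ℂ}
    (hf : InnerProductSpace.HarmonicContOnCl f unitDisk) {z : ℂ} (hz : z ∈ unitDisk) :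
    ContinuousAt (fderiv ℝ f) z :=
  ((hf.contDiffAt hz).fderiv_right (m := 1) (by norm_num)).continuousAt

/-- For a harmonic map the distortion inequality holds at every point. -/
theorem maxStretch_sq_le {K : ℝ} {f : ℂ → ℂ}
    (hf : InnerProductSpace.HarmonicContOnCl f unitDisk)
    (h : ∀ᵐ z ∂(volume.restrict unitDisk), maxStretch f z ^ 2 ≤ K * jac f z)
    {z : ℂ} (hz : z ∈ unitDisk) : maxStretch f z ^ 2 ≤ K * jac f z := by
  have hO : IsOpen unitDisk := Metric.isOpen_ball
  have hev : ∀ᶠ w in nhds z, w ∈ unitDisk := hO.mem_nhds hz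
  have hline : ∀ v : ℂ, ContinuousAt (fun w => lineDeriv ℝ f w v) z := fun v => by
    refine ContinuousAt.congr
      ((hf.continuousAt_fderiv hz).clm_apply (continuousAt_const (y := v))) ?_
    filter_upwards [hev] with w hw
    exact ((hf.differentiableAt hw).lineDeriv_eq_fderiv).symm
  have h1 := hline 1
  have h2 := hline Complex.I
  have hdz : ContinuousAt (dz f) z := by unfold dz; fun_prop
  have hdzbar : ContinuousAt (dzbar f) z := by unfold dzbar; fun_prop
  by_contra hc
  -- Both sides are continuous, so a violation at z persists on a neighbourhood, which has positive
  -- measure.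
  have hlt : ∀ᶠ w in nhds z, K * jac f w < maxStretch f w ^ 2 := by
    refine ContinuousAt.eventually_lt ?_ ?_ (not_le.1 hc)
    · unfold jac; fun_prop
    · unfold maxStretch; fun_prop
  have hpos := Measure.measure_pos_of_mem_nhds (volume : Measure ℂ) (hlt.and hev)
  rw [ae_restrict_iff' hO.measurableSet, ae_iff] at h
  refine hpos.ne' (measure_mono_null ?_ h)
  intro w hw
  simp only [mem_ofPred_eq, Classical.not_imp, not_le]
  exact ⟨hw.2, hw.1⟩

/-- The Jacobian is the product of the maximal and minimal stretches, so one factor cancels; if the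
maximal stretch vanishes, both sides are zero. -/
theorem maxStretch_le_mul_sub {K : ℝ} {f : ℂ → ℂ} {z : ℂ}
    (h : maxStretch f z ^ 2 ≤ K * jac f z) :
    maxStretch f z ≤ K * (‖dz f z‖ - ‖dzbar f z‖) := by
  have h0 : 0 ≤ maxStretch f z := add_nonneg (norm_nonneg _) (norm_nonneg _)
  rcases h0.eq_or_lt with h0 | h0
  · have h1 : ‖dz f z‖ = 0 := by
      have := norm_nonneg (dz f z); have := norm_nonneg (dzbar f z)
      unfold maxStretch at h0; linarith
    have h2 : ‖dzbar f z‖ = 0 := by unfold maxStretch at h0; linarith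
    rw [← h0, h1, h2]; simp
  · have e : jac f z = (‖dz f z‖ - ‖dzbar f z‖) * maxStretch f z := by
      unfold jac maxStretch; ring
    rw [e, sq, ← mul_assoc] at h
    exact le_of_mul_le_mul_right h h0

/-- Since u is its own Poisson integral, `abs_poissonInt_sub_le` is a Lipschitz bound for u near z,
and it passes to the derivative. -/
theorem norm_fderiv_le_poissonInt {u : ℂ → ℝ}
    (hu : InnerProductSpace.HarmonicContOnCl u unitDisk) (c : ℝ) {z : ℂ} (hz : ‖z‖ < 1) :
    ‖fderiv ℝ u z‖ ≤ 4 / (1 - ‖z‖) * poissonInt (fun ζ => |u ζ - c|) z := by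
  have hd : 0 < 1 - ‖z‖ := by linarith
  have hus : ContinuousOn u (Metric.sphere 0 1) :=
    hu.continuousOn_ball.mono Metric.sphere_subset_closedBall
  have h0 : 0 ≤ poissonInt (fun ζ => |u ζ - c|) z := by
    rw [← poissonInt_const 0 hz]
    exact poissonInt_mono continuousOn_const (hus.sub continuousOn_const).abs hz
      fun ζ _ => abs_nonneg _
  refine (hu.differentiableAt (mem_ball_zero_iff.2 hz)).hasFDerivAt.le_of_lip'
    (by positivity) ?_
  filter_upwards [Metric.closedBall_mem_nhds z (show 0 < (1 - ‖z‖) / 2 by linarith)] with w hw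
  have hw' : ‖w - z‖ ≤ (1 - ‖z‖) / 2 := by simpa [dist_eq_norm] using hw
  have hw1 : ‖w‖ < 1 := by
    have : ‖w‖ ≤ ‖w - z‖ + ‖z‖ := by simpa using norm_add_le (w - z) z
    linarith
  have := abs_poissonInt_sub_le hus c hz hw'
  rw [hu.poissonInt_eq hz, hu.poissonInt_eq hw1] at this
  calc ‖u w - u z‖ ≤ _ := this
    _ = _ := by ring

theorem exists_norm_eq_one_mul_eq_norm (w : ℂ) : ∃ l : ℂ, ‖l‖ = 1 ∧ l * w = ‖w‖ := by
  rcases eq_or_ne w 0 with rfl | hw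
  · exact ⟨1, by simp, by simp⟩
  · have h : (‖w‖ : ℂ) ≠ 0 := by simpa using hw
    refine ⟨‖w‖ / w, ?_, div_mul_cancel₀ _ hw⟩
    have h' : ‖w‖ ≠ 0 := by simpa using hw
    simp [h']

theorem InnerProductSpace.HarmonicContOnCl.re_mul {f : ℂ → ℂ}
    (hf : InnerProductSpace.HarmonicContOnCl f unitDisk) (l : ℂ) :
    InnerProductSpace.HarmonicContOnCl (fun w => (l * f w).re) unitDisk :=
  HarmonicContOnCl.comp_CLM hf (Complex.reCLM.comp (l • ContinuousLinearMap.id ℝ ℂ))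

theorem InnerProductSpace.HarmonicContOnCl.continuousOn_sphere {F : Type*} [NormedAddCommGroup F]
    [NormedSpace ℝ F] {f : ℂ → F} (hf : InnerProductSpace.HarmonicContOnCl f unitDisk) :
    ContinuousOn f (Metric.sphere 0 1) :=
  hf.continuousOn_ball.mono Metric.sphere_subset_closedBall

/-- Rotating f so that its value at z is nonnegative reduces the claim to Re(l f) ≤ |f| on the
circle. -/
theorem norm_le_poissonInt_norm {f : ℂ → ℂ}
    (hf : InnerProductSpace.HarmonicContOnCl f unitDisk) {z : ℂ} (hz : ‖z‖ < 1) :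
    ‖f z‖ ≤ poissonInt (fun w => ‖f w‖) z := by
  obtain ⟨l, hl, hlz⟩ := exists_norm_eq_one_mul_eq_norm (f z)
  have hu := hf.re_mul l
  have e : ‖f z‖ = (l * f z).re := by rw [hlz, Complex.ofReal_re]
  rw [e, ← hu.poissonInt_eq hz]
  refine poissonInt_mono hu.continuousOn_sphere hf.continuousOn_sphere.norm hz fun ζ _ => ?_
  refine (Complex.re_le_norm _).trans ?_
  rw [norm_mul, hl, one_mul]

/-- The derivative of a harmonic quasiregular map is controlled by `P[|f|] - |f|` and the
oscillation of the boundary function of `|f|`. -/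
theorem norm_fderiv_le {K : ℝ} (hK : 0 ≤ K) {f : ℂ → ℂ}
    (hf : InnerProductSpace.HarmonicContOnCl f unitDisk)
    (hqr : ∀ᵐ z ∂(volume.restrict unitDisk), maxStretch f z ^ 2 ≤ K * jac f z)
    (c : ℝ) {z : ℂ} (hz : ‖z‖ < 1) :
    ‖fderiv ℝ f z‖ ≤ K * (4 / (1 - ‖z‖)) * ((poissonInt (fun w => ‖f w‖) z - ‖f z‖) +
      poissonInt (fun ζ => |‖f ζ‖ - c|) z) := by
  have hz' : z ∈ unitDisk := mem_ball_zero_iff.2 hz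
  have hd : 0 < 1 - ‖z‖ := by linarith
  obtain ⟨l, hl, hlz⟩ := exists_norm_eq_one_mul_eq_norm (f z)
  have hu := hf.re_mul l
  have e : (l * f z).re = ‖f z‖ := by rw [hlz, Complex.ofReal_re]
  have hus := hu.continuousOn_sphere
  have hfs := hf.continuousOn_sphere.norm
  have hosc : ContinuousOn (fun ζ => |‖f ζ‖ - c|) (Metric.sphere 0 1) :=
    (hfs.sub continuousOn_const).abs
  have hdiff : ContinuousOn (fun ζ => ‖f ζ‖ - (l * f ζ).re) (Metric.sphere 0 1) := hfs.sub hus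
  -- With u = Re(l f), on the circle |u - c| ≤ (|f| - u) + ||f| - c|. The first term has Poisson
  -- integral P[|f|](z) - |f(z)| at z, because u(z) = |f(z)|.
  have key : poissonInt (fun ζ => |(l * f ζ).re - c|) z ≤
      (poissonInt (fun w => ‖f w‖) z - ‖f z‖) + poissonInt (fun ζ => |‖f ζ‖ - c|) z := by
    rw [← e, ← hu.poissonInt_eq hz, ← poissonInt_sub hfs hus hz,
      ← poissonInt_add hdiff hosc hz]
    refine poissonInt_mono (hus.sub continuousOn_const).abs (hdiff.add hosc) hz
      fun ζ _ => ?_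
    have h1 : (l * f ζ).re ≤ ‖f ζ‖ := by
      refine (Complex.re_le_norm _).trans ?_
      rw [norm_mul, hl, one_mul]
    have h2 := abs_sub_le (l * f ζ).re ‖f ζ‖ c
    rw [abs_sub_comm _ ‖f ζ‖, abs_of_nonneg (sub_nonneg.2 h1)] at h2
    exact h2
  calc ‖fderiv ℝ f z‖ ≤ maxStretch f z := norm_fderiv_le_maxStretch (hf.differentiableAt hz')
    _ ≤ K * (‖dz f z‖ - ‖dzbar f z‖) := maxStretch_le_mul_sub (maxStretch_sq_le hf hqr hz')
    _ ≤ K * (4 / (1 - ‖z‖) * poissonInt (fun ζ => |(l * f ζ).re - c|) z) := by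
        gcongr
        exact (norm_dz_sub_norm_dzbar_le (hf.differentiableAt hz') hl).trans
          (norm_fderiv_le_poissonInt hu c hz)
    _ ≤ _ := by rw [mul_assoc]; gcongr

/-! ### L^p differences under rotation -/

theorem rotNorm_comm {E : Type*} [NormedAddCommGroup E] (p : ENNReal) (f : ℂ → E) (z₁ z₂ : ℂ) :
    rotNorm p f z₁ z₂ = rotNorm p f z₂ z₁ :=
  eLpNorm_sub_comm _ _ _ _

theorem continuous_comp_rotation {E : Type*} [TopologicalSpace E] {f : ℂ → E} {S : Set ℂ}
    (hf : ContinuousOn f S) (hS : ∀ z ∈ S, ∀ η : ℝ, Complex.exp (η * Complex.I) * z ∈ S) {z : ℂ}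
    (hz : z ∈ S) : Continuous fun η : ℝ => f (Complex.exp (η * Complex.I) * z) :=
  hf.comp_continuous (by fun_prop) (hS z hz)

theorem exp_mul_mem_unitDisk (z : ℂ) (hz : z ∈ unitDisk) (η : ℝ) :
    Complex.exp (η * Complex.I) * z ∈ unitDisk := by
  rw [unitDisk, mem_ball_zero_iff] at *
  rwa [norm_exp_mul_I_mul]

theorem exp_mul_mem_closedBall (z : ℂ) (hz : z ∈ Metric.closedBall (0 : ℂ) 1) (η : ℝ) :
    Complex.exp (η * Complex.I) * z ∈ Metric.closedBall (0 : ℂ) 1 := by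
  rw [mem_closedBall_zero_iff] at *
  rwa [norm_exp_mul_I_mul]

theorem exp_mul_mem_sphere (z : ℂ) (hz : z ∈ Metric.sphere (0 : ℂ) 1) (η : ℝ) :
    Complex.exp (η * Complex.I) * z ∈ Metric.sphere (0 : ℂ) 1 := by
  rw [mem_sphere_zero_iff_norm] at *
  rwa [norm_exp_mul_I_mul]

theorem rotNorm_triangle {E : Type*} [NormedAddCommGroup E] {p : ENNReal} (hp : 1 ≤ p)
    {f : ℂ → E} (hf : ContinuousOn f unitDisk) {z₁ z₂ z₃ : ℂ} (h₁ : z₁ ∈ unitDisk)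
    (h₂ : z₂ ∈ unitDisk) (h₃ : z₃ ∈ unitDisk) :
    rotNorm p f z₁ z₃ ≤ rotNorm p f z₁ z₂ + rotNorm p f z₂ z₃ := by
  have c₁ := continuous_comp_rotation hf exp_mul_mem_unitDisk h₁
  have c₂ := continuous_comp_rotation hf exp_mul_mem_unitDisk h₂
  have c₃ := continuous_comp_rotation hf exp_mul_mem_unitDisk h₃
  have := eLpNorm_add_le (μ := volume.restrict (Ioc 0 (2 * Real.pi)))
    (c₁.sub c₂).aestronglyMeasurable (c₂.sub c₃).aestronglyMeasurable hp
  rw [sub_add_sub_cancel] at this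
  exact this

/-- Only p = ∞ needs an argument: continuity turns the essential bound over rotations into a bound
at η = 0. -/
theorem rotDiff_le_rotNorm {E : Type*} [NormedAddCommGroup E] (p : ENNReal)
    {f : ℂ → E} (hf : ContinuousOn f unitDisk) {z₁ z₂ : ℂ} (h₁ : z₁ ∈ unitDisk)
    (h₂ : z₂ ∈ unitDisk) : rotDiff p f z₁ z₂ ≤ rotNorm p f z₁ z₂ := by
  unfold rotDiff
  split_ifs with hp
  · subst hp
    have c₁ := continuous_comp_rotation hf exp_mul_mem_unitDisk h₁
    have c₂ := continuous_comp_rotation hf exp_mul_mem_unitDisk h₂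
    simpa using enorm_le_of_eLpNorm_top_le (c₁.sub c₂) Real.two_pi_pos
      (le_refl (rotNorm ⊤ f z₁ z₂)) (left_mem_Icc.2 Real.two_pi_pos.le)
  · exact le_rfl

/-- For p = ∞ a pointwise bound on a rotation-invariant set applies to every rotated pair, because
rotations preserve |z₁ - z₂|. -/
theorem rotNorm_le_of_rotDiff_le {E : Type*} [NormedAddCommGroup E] {p : ENNReal} {f : ℂ → E}
    {S : Set ℂ} (hS : ∀ z ∈ S, ∀ η : ℝ, Complex.exp (η * Complex.I) * z ∈ S) {B : ℝ → ENNReal}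
    (h : ∀ z₁ ∈ S, ∀ z₂ ∈ S, rotDiff p f z₁ z₂ ≤ B ‖z₁ - z₂‖) {z₁ z₂ : ℂ} (h₁ : z₁ ∈ S)
    (h₂ : z₂ ∈ S) : rotNorm p f z₁ z₂ ≤ B ‖z₁ - z₂‖ := by
  by_cases hp : p = ⊤
  · subst hp
    rw [rotNorm, eLpNorm_exponent_top]
    refine eLpNormEssSup_le_of_ae_enorm_bound (Filter.Eventually.of_forall fun η => ?_)
    have := h _ (hS _ h₁ η) _ (hS _ h₂ η)
    rwa [rotDiff, if_pos rfl, ← mul_sub, norm_exp_mul_I_mul] at this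
  · have := h _ h₁ _ h₂
    rwa [rotDiff, if_neg hp] at this

/-- A Lipschitz estimate in the disk extends to the closed disk. -/
theorem rotNorm_le_of_mem_closedBall {E : Type*} [NormedAddCommGroup E] {p : ENNReal}
    {ω : ℝ → ℝ} (hω : IsMajorant ω) {M : ℝ} (hM : 0 ≤ M)
    {f : ℂ → E} (hf : ContinuousOn f (Metric.closedBall 0 1))
    (h : ∀ z₁ ∈ unitDisk, ∀ z₂ ∈ unitDisk, rotNorm p f z₁ z₂ ≤ ENNReal.ofReal (M * ω ‖z₁ - z₂‖))
    {z₁ z₂ : ℂ} (h₁ : z₁ ∈ Metric.closedBall (0 : ℂ) 1) (h₂ : z₂ ∈ Metric.closedBall (0 : ℂ) 1) :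
    rotNorm p f z₁ z₂ ≤ ENNReal.ofReal (M * ω ‖z₁ - z₂‖) := by
  -- The dilations by n/(n + 1) move the closed disk into the open one and shrink distances; Fatou's
  -- lemma for the L^p norm passes to the limit.
  set r : ℕ → ℝ := fun n => n / (n + 1) with hr
  have hr0 : ∀ n, 0 ≤ r n := fun n => by positivity
  have hr1 : ∀ n, r n < 1 := fun n => by
    rw [hr]; simp only; rw [div_lt_one (by positivity)]; linarith
  have hrn : ∀ n, ‖(r n : ℂ)‖ = r n := fun n => by
    rw [Complex.norm_real, Real.norm_eq_abs, abs_of_nonneg (hr0 n)]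
  have hlim : Filter.Tendsto (fun n => (r n : ℂ)) Filter.atTop (nhds 1) := by
    have : Filter.Tendsto r Filter.atTop (nhds 1) := tendsto_natCast_div_add_atTop 1
    exact_mod_cast (Complex.continuous_ofReal.tendsto 1).comp this
  have hmem : ∀ n, ∀ z ∈ Metric.closedBall (0 : ℂ) 1, (r n : ℂ) * z ∈ unitDisk := fun n z hz => by
    rw [unitDisk, mem_ball_zero_iff, norm_mul, hrn]
    rw [mem_closedBall_zero_iff] at hz
    nlinarith [norm_nonneg z, hr0 n, hr1 n]
  have htend : ∀ z ∈ Metric.closedBall (0 : ℂ) 1, ∀ η : ℝ,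
      Filter.Tendsto (fun n => f (Complex.exp (η * Complex.I) * (r n * z))) Filter.atTop
        (nhds (f (Complex.exp (η * Complex.I) * z))) := fun z hz η => by
    refine (hf _ (exp_mul_mem_closedBall z hz η)).tendsto.comp ?_
    rw [tendsto_nhdsWithin_iff]
    refine ⟨?_, Filter.Eventually.of_forall fun n => ?_⟩
    · simpa using (hlim.mul_const z).const_mul (Complex.exp (η * Complex.I))
    · exact exp_mul_mem_closedBall _ (Metric.ball_subset_closedBall (hmem n z hz)) η
  have hfd := hf.mono (Metric.ball_subset_closedBall : unitDisk ⊆ _)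
  have := Lp.eLpNorm_lim_le_liminf_eLpNorm (p := p) (μ := volume.restrict (Ioc 0 (2 * Real.pi)))
    (f := fun n (η : ℝ) => f (Complex.exp (η * Complex.I) * (r n * z₁)) -
      f (Complex.exp (η * Complex.I) * (r n * z₂)))
    (fun n => ((continuous_comp_rotation hfd exp_mul_mem_unitDisk (hmem n _ h₁)).sub
      (continuous_comp_rotation hfd exp_mul_mem_unitDisk (hmem n _ h₂))).aestronglyMeasurable)
    (fun η : ℝ => f (Complex.exp (η * Complex.I) * z₁) - f (Complex.exp (η * Complex.I) * z₂))
    (Filter.Eventually.of_forall fun η => (htend z₁ h₁ η).sub (htend z₂ h₂ η))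
  refine this.trans ?_
  rw [← Filter.liminf_const (f := Filter.atTop (α := ℕ)) (ENNReal.ofReal (M * ω ‖z₁ - z₂‖))]
  refine Filter.liminf_le_liminf (Filter.Eventually.of_forall fun n => ?_)
  refine (h _ (hmem n _ h₁) _ (hmem n _ h₂)).trans (ENNReal.ofReal_le_ofReal ?_)
  refine mul_le_mul_of_nonneg_left
    (hω.mono (mem_Ici.2 (norm_nonneg _)) (mem_Ici.2 (norm_nonneg _)) ?_) hM
  rw [← mul_sub, norm_mul, hrn]
  exact mul_le_of_le_one_left (norm_nonneg _) (hr1 n).le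

/-! ### From derivative growth to Lipschitz estimates -/

/-- The fundamental theorem of calculus on each rotated segment, followed by Minkowski: the
direction e^{iη}b has length |b| for every η. -/
theorem rotNorm_add_mul_le_lintegral {p : ENNReal} (hp : 1 ≤ p) {f : ℂ → ℂ}
    (hf : InnerProductSpace.HarmonicContOnCl f unitDisk) {a b : ℂ} {s : ℝ} (hs : 0 ≤ s)
    (hab : ∀ t ∈ Icc 0 s, ‖a + t * b‖ < 1) {B : ℝ → ENNReal}
    (hB : AEMeasurable B (volume.restrict (Ioo 0 s)))
    (h : ∀ t ∈ Ioo 0 s, ‖b‖ₑ * eLpNorm (fun η : ℝ => fderiv ℝ f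
      (Complex.exp (η * Complex.I) * (a + t * b))) p (volume.restrict (Ioc 0 (2 * Real.pi))) ≤ B t) :
    rotNorm p f (a + s * b) a ≤ ∫⁻ t in Ioo 0 s, B t := by
  set F : ℝ → ℝ → ENNReal := fun η t =>
    ‖‖b‖ • fderiv ℝ f (Complex.exp (η * Complex.I) * (a + t * b))‖ₑ with hF
  have hFm : Measurable (Function.uncurry F) := by
    have hc : Continuous fun x : ℝ × ℝ => Complex.exp (x.1 * Complex.I) * (a + x.2 * b) := by
      fun_prop
    exact (((measurable_fderiv ℝ f).comp hc.measurable).const_smul ‖b‖).enorm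
  refine le_trans ?_ (eLpNorm_lintegral_le
    (μ := volume.restrict (Ioc 0 (2 * Real.pi))) hp hFm hB ?_)
  · refine eLpNorm_mono_enorm fun η => ?_
    rw [enorm_eq_self]
    set e := Complex.exp (η * Complex.I) with he
    have hmem : ∀ t ∈ Icc 0 s, e * (a + t * b) ∈ unitDisk := fun t ht =>
      exp_mul_mem_unitDisk _ (mem_ball_zero_iff.2 (hab t ht)) η
    have hderiv : ∀ t ∈ uIcc 0 s, HasDerivAt (fun t : ℝ => f (e * (a + t * b)))
        (fderiv ℝ f (e * (a + t * b)) (e * b)) t := fun t ht => by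
      rw [uIcc_of_le hs] at ht
      refine (hf.differentiableAt (hmem t ht)).hasFDerivAt.comp_hasDerivAt t ?_
      have : HasDerivAt (fun t : ℝ => (t : ℂ)) 1 t := Complex.ofRealCLM.hasDerivAt
      simpa using ((this.mul_const b).const_add a).const_mul e
    have hcont : ContinuousOn (fun t : ℝ => fderiv ℝ f (e * (a + t * b)) (e * b)) (uIcc 0 s) := by
      rw [uIcc_of_le hs]
      intro t ht
      refine ContinuousAt.continuousWithinAt (ContinuousAt.clm_apply ?_ continuousAt_const)
      refine ContinuousAt.comp (f := fun t : ℝ => e * (a + t * b))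
        (hf.continuousAt_fderiv (hmem t ht)) (Continuous.continuousAt ?_)
      fun_prop
    have hint := intervalIntegral.integral_eq_sub_of_hasDerivAt hderiv hcont.intervalIntegrable
    simp only [Complex.ofReal_zero, zero_mul, add_zero] at hint
    rw [← hint, intervalIntegral.integral_of_le hs, integral_Ioc_eq_integral_Ioo]
    refine (enorm_integral_le_lintegral_enorm _).trans (lintegral_mono fun t => ?_)
    refine (ContinuousLinearMap.le_opENorm _ _).trans ?_
    have hb : ‖e * b‖ₑ = ‖b‖ₑ := by
      rw [← ofReal_norm, ← ofReal_norm, he, norm_exp_mul_I_mul]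
    simp only [hF, enorm_smul, enorm_norm, hb]
    rw [mul_comm]
  · filter_upwards [ae_restrict_mem measurableSet_Ioo] with t ht
    refine le_trans (le_of_eq ?_) (h t ht)
    simp only [hF]
    rw [eLpNorm_enorm, ← enorm_norm b, ← eLpNorm_const_smul]
    rfl

/-- Hardy-Littlewood: a growth estimate for the derivative gives a Lipschitz estimate. -/
theorem exists_rotNorm_le_of_eLpNorm_fderiv_le {p : ENNReal} (hp : 1 ≤ p) {ω : ℝ → ℝ}
    (hω : IsMajorant ω) (hfast : IsFast ω) {f : ℂ → ℂ}
    (hf : InnerProductSpace.HarmonicContOnCl f unitDisk) {C : ℝ} (hC : 0 ≤ C)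
    (h : ∀ z ∈ unitDisk, eLpNorm (fun η : ℝ => fderiv ℝ f (Complex.exp (η * Complex.I) * z)) p
      (volume.restrict (Ioc 0 (2 * Real.pi))) ≤
        ENNReal.ofReal (C * (ω (1 - ‖z‖) / (1 - ‖z‖)))) :
    ∃ M : ℝ, 0 < M ∧ ∀ z₁ ∈ unitDisk, ∀ z₂ ∈ unitDisk,
      rotNorm p f z₁ z₂ ≤ ENNReal.ofReal (M * ω ‖z₁ - z₂‖) := by
  obtain ⟨A, hA, hfast⟩ := hω.exists_fast hfast
  -- Two radial legs cost CA each and the middle leg C; the 1 ensures positivity when C = 0.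
  refine ⟨C * A + C + C * A + 1, by positivity, fun z₁ h₁ z₂ h₂ => ?_⟩
  have hfd : ContinuousOn f unitDisk := hf.continuousOn.mono subset_closure
  rcases eq_or_ne z₁ z₂ with rfl | hne
  · simp [rotNorm]
  have hδ : 0 < ‖z₁ - z₂‖ := norm_pos_iff.2 (sub_ne_zero.2 hne)
  -- The path runs from z₁ to (1 - s)z₁ to (1 - s)z₂ to z₂. The fast condition handles the radial
  -- legs; the middle leg has length at most s and stays at distance at least s from the circle. The
  -- cap at 1 keeps 1 - s nonnegative.
  set s := min ‖z₁ - z₂‖ 1 with hsdef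
  have hs : 0 < s := lt_min hδ one_pos
  have hs1 : s ≤ 1 := min_le_right _ _
  have hωs : ω s ≤ ω ‖z₁ - z₂‖ := hω.mono (mem_Ici.2 hs.le) (mem_Ici.2 hδ.le) (min_le_left _ _)
  have hω0 := hω.nonneg hs.le
  have hω1 := hω.nonneg hδ.le
  have hnorm : ∀ t : ℝ, 0 ≤ t → t ≤ 1 → ∀ z : ℂ, ‖z + t * -z‖ = (1 - t) * ‖z‖ :=
    fun t ht ht1 z => by
      have : z + t * -z = ((1 - t : ℝ) : ℂ) * z := by push_cast; ring
      rw [this, norm_mul, Complex.norm_real, Real.norm_eq_abs, abs_of_nonneg (by linarith)]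
  have hmem : ∀ z ∈ unitDisk, z + s * -z ∈ unitDisk := fun z hz => by
    rw [unitDisk, mem_ball_zero_iff] at *
    rw [hnorm s hs.le hs1]
    nlinarith [norm_nonneg z]
  have hder : ∀ τ : ℝ, 0 < τ → ∀ z ∈ unitDisk, τ ≤ 1 - ‖z‖ →
      eLpNorm (fun η : ℝ => fderiv ℝ f (Complex.exp (η * Complex.I) * z)) p
        (volume.restrict (Ioc 0 (2 * Real.pi))) ≤ ENNReal.ofReal (C * (ω τ / τ)) :=
    fun τ hτ z hz hτz => (h z hz).trans (ENNReal.ofReal_le_ofReal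
      (mul_le_mul_of_nonneg_left (hω.div_le_div hτ hτz) hC))
  have hrad : ∀ z ∈ unitDisk, rotNorm p f (z + s * -z) z ≤ ENNReal.ofReal (C * A * ω s) := by
    intro z hz
    have hz1 : ‖z‖ < 1 := mem_ball_zero_iff.1 hz
    have hlt : ∀ t ∈ Icc 0 s, ‖z + t * -z‖ < 1 := fun t ht => by
      rw [hnorm t ht.1 (ht.2.trans hs1)]
      nlinarith [norm_nonneg z, ht.1]
    have hm : AEMeasurable (fun t => ENNReal.ofReal (ω t / t)) (volume.restrict (Ioo 0 s)) := by
      refine AEMeasurable.ennreal_ofReal (AEMeasurable.div ?_ aemeasurable_id)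
      exact (hω.continuousOn.mono fun t ht => mem_Ici.2 ht.1.le).aemeasurable measurableSet_Ioo
    calc rotNorm p f (z + s * -z) z
        ≤ ∫⁻ t in Ioo 0 s, ENNReal.ofReal C * ENNReal.ofReal (ω t / t) := by
          refine rotNorm_add_mul_le_lintegral hp hf hs.le hlt (hm.const_mul _) fun t ht => ?_
          have ht1 : t ≤ 1 := ht.2.le.trans hs1
          have hb : ‖-z‖ₑ ≤ 1 := by
            rw [enorm_neg, ← ofReal_norm, ← ENNReal.ofReal_one]
            exact ENNReal.ofReal_le_ofReal hz1.le
          rw [← ENNReal.ofReal_mul hC, ← one_mul (ENNReal.ofReal _)]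
          refine mul_le_mul' hb
            (hder t ht.1 _ (mem_ball_zero_iff.2 (hlt t ⟨ht.1.le, ht.2.le⟩)) ?_)
          rw [hnorm t ht.1.le ht1]
          nlinarith [norm_nonneg z]
      _ = ENNReal.ofReal C * ∫⁻ t in Ioo 0 s, ENNReal.ofReal (ω t / t) :=
          lintegral_const_mul' _ _ ENNReal.ofReal_ne_top
      _ ≤ ENNReal.ofReal C * ENNReal.ofReal (A * ω s) := by gcongr; exact hfast s hs hs1
      _ = _ := by rw [← ENNReal.ofReal_mul hC, mul_assoc]
  have hseg : rotNorm p f (z₁ + s * -z₁) (z₂ + s * -z₂) ≤ ENNReal.ofReal (C * ω s) := by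
    set b : ℂ := ((1 - s : ℝ) : ℂ) * (z₁ - z₂) with hb
    have hbs : ‖b‖ ≤ s := by
      rw [hb, norm_mul, Complex.norm_real, Real.norm_eq_abs, abs_of_nonneg (by linarith)]
      rcases le_total ‖z₁ - z₂‖ 1 with hc | hc
      · rw [hsdef, min_eq_left hc]; nlinarith
      · rw [hsdef, min_eq_right hc]; simp
    have hle : ∀ t ∈ Icc (0 : ℝ) 1, ‖z₂ + s * -z₂ + t * b‖ < 1 ∧
        s ≤ 1 - ‖z₂ + s * -z₂ + t * b‖ := fun t ht => by
      have e : z₂ + s * -z₂ + t * b =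
          ((1 - s : ℝ) : ℂ) * (((1 - t : ℝ) : ℂ) * z₂ + ((t : ℝ) : ℂ) * z₁) := by
        rw [hb]; push_cast; ring
      have h3 : ‖((1 - t : ℝ) : ℂ) * z₂ + ((t : ℝ) : ℂ) * z₁‖ ≤ 1 := by
        refine (norm_add_le _ _).trans ?_
        rw [norm_mul, norm_mul, Complex.norm_real, Complex.norm_real, Real.norm_eq_abs,
          Real.norm_eq_abs, abs_of_nonneg ht.1, abs_of_nonneg (by linarith [ht.2])]
        have := mem_ball_zero_iff.1 h₁
        have := mem_ball_zero_iff.1 h₂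
        nlinarith [ht.1, ht.2]
      have h4 : ‖z₂ + s * -z₂ + t * b‖ ≤ 1 - s := by
        rw [e, norm_mul, Complex.norm_real, Real.norm_eq_abs, abs_of_nonneg (by linarith)]
        exact mul_le_of_le_one_right (by linarith) h3
      constructor <;> linarith
    have e1 : z₁ + s * -z₁ = z₂ + s * -z₂ + (1 : ℝ) * b := by
      rw [hb]; push_cast; ring
    rw [e1]
    calc rotNorm p f (z₂ + s * -z₂ + (1 : ℝ) * b) (z₂ + s * -z₂)
        ≤ ∫⁻ _ in Ioo (0 : ℝ) 1, ENNReal.ofReal (C * ω s) := by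
          refine rotNorm_add_mul_le_lintegral hp hf zero_le_one (fun t ht => (hle t ht).1)
            aemeasurable_const fun t ht => ?_
          have ht' : t ∈ Icc (0 : ℝ) 1 := ⟨ht.1.le, ht.2.le⟩
          calc _ ≤ ENNReal.ofReal s * ENNReal.ofReal (C * (ω s / s)) := by
                refine mul_le_mul' ?_
                  (hder s hs _ (mem_ball_zero_iff.2 (hle t ht').1) (hle t ht').2)
                rw [← ofReal_norm]
                exact ENNReal.ofReal_le_ofReal hbs
            _ = ENNReal.ofReal (C * ω s) := by
                rw [← ENNReal.ofReal_mul hs.le]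
                congr 1; field_simp
      _ = ENNReal.ofReal (C * ω s) := by simp
  calc rotNorm p f z₁ z₂
      ≤ rotNorm p f z₁ (z₁ + s * -z₁) + (rotNorm p f (z₁ + s * -z₁) (z₂ + s * -z₂) +
          rotNorm p f (z₂ + s * -z₂) z₂) :=
        (rotNorm_triangle hp hfd h₁ (hmem _ h₁) h₂).trans
          (add_le_add_right (rotNorm_triangle hp hfd (hmem _ h₁) (hmem _ h₂) h₂) _)
    _ ≤ ENNReal.ofReal (C * A * ω s) + (ENNReal.ofReal (C * ω s) +
          ENNReal.ofReal (C * A * ω s)) := by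
        rw [rotNorm_comm p f z₁]
        exact add_le_add (hrad _ h₁) (add_le_add hseg (hrad _ h₂))
    _ = ENNReal.ofReal ((C * A + C + C * A) * ω s) := by
        rw [← ENNReal.ofReal_add (by positivity) (by positivity),
          ← ENNReal.ofReal_add (by positivity) (by positivity)]
        congr 1; ring
    _ ≤ _ := by
        refine ENNReal.ofReal_le_ofReal ?_
        have : 0 ≤ C * A + C + C * A := by positivity
        nlinarith

/-! ### Boundary distance and the growth condition as an L^p estimate -/

theorem bdryDist_of_mem {z : ℂ} (hz : z ∈ unitDisk) : bdryDist z = 1 - ‖z‖ := by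
  have hz1 : ‖z‖ < 1 := mem_ball_zero_iff.1 hz
  rw [bdryDist, unitDisk, frontier_ball _ one_ne_zero]
  apply le_antisymm
  · obtain ⟨l, hl, hlz⟩ := exists_norm_eq_one_mul_eq_norm z
    have hl0 : l ≠ 0 := norm_pos_iff.1 (hl ▸ one_pos)
    have hmem : l⁻¹ ∈ Metric.sphere (0 : ℂ) 1 := by simp [hl]
    refine (Metric.infDist_le_dist_of_mem hmem).trans (le_of_eq ?_)
    have e : z - l⁻¹ = l⁻¹ * ((‖z‖ - 1 : ℝ) : ℂ) := by
      push_cast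
      rw [← hlz]
      field_simp
    rw [dist_eq_norm, e, norm_mul, norm_inv, hl, inv_one, one_mul, Complex.norm_real,
      Real.norm_eq_abs, abs_sub_comm, abs_of_pos (by linarith)]
  · refine (Metric.le_infDist ⟨1, by simp⟩).2 fun ζ hζ => ?_
    rw [dist_comm, dist_eq_norm]
    exact one_sub_norm_le_norm_sub (mem_sphere_zero_iff_norm.1 hζ)

theorem exists_polar (z : ℂ) : ∃ ξ : ℂ, ‖ξ‖ = 1 ∧ (‖z‖ : ℂ) * ξ = z := by
  obtain ⟨l, hl, hlz⟩ := exists_norm_eq_one_mul_eq_norm z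
  have hl0 : l ≠ 0 := norm_pos_iff.1 (hl ▸ one_pos)
  refine ⟨l⁻¹, by simp [hl], ?_⟩
  rw [← hlz]
  field_simp

theorem eLpNorm_eq_ofReal_integral_rpow {p : ENNReal} (hp : 1 ≤ p) (hpt : p ≠ ⊤) {g : ℝ → ℝ}
    (hg : Continuous g) (hg0 : ∀ x, 0 ≤ g x) {a b : ℝ} (hab : a ≤ b) :
    eLpNorm g p (volume.restrict (Ioc a b)) =
      ENNReal.ofReal ((∫ x in a..b, g x ^ p.toReal) ^ (1 / p.toReal)) := by
  have hp0 : p ≠ 0 := (zero_lt_one.trans_le hp).ne'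
  have hr0 : 0 < p.toReal := ENNReal.toReal_pos hp0 hpt
  have hgc : Continuous fun x => g x ^ p.toReal := hg.rpow_const fun _ => Or.inr hr0.le
  rw [eLpNorm_eq_lintegral_rpow_enorm_toReal hp0 hpt, intervalIntegral.integral_of_le hab,
    ← ENNReal.ofReal_rpow_of_nonneg
      (integral_nonneg fun x => Real.rpow_nonneg (hg0 x) _) (by positivity),
    ofReal_integral_eq_lintegral_ofReal
      ((hgc.integrableOn_Icc (a := a) (b := b)).mono_set Ioc_subset_Icc_self)
      (Filter.Eventually.of_forall fun x => Real.rpow_nonneg (hg0 x) _)]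
  congr 1
  refine lintegral_congr fun x => ?_
  rw [Real.enorm_eq_ofReal (hg0 x), ENNReal.ofReal_rpow_of_nonneg (hg0 x) hr0.le]

/-- Supplies the measurability that the triangle inequality in L^p requires. -/
theorem continuous_poissonInt_norm_sub {E : Type*} [NormedAddCommGroup E] {φ : ℂ → E}
    (hφ : ContinuousOn φ (Metric.sphere 0 1)) {r : ℝ} (hr : 0 ≤ r) (hr1 : r < 1) {ξ : ℂ}
    (hξ : ‖ξ‖ = 1) : Continuous fun η : ℝ =>
      poissonInt (fun ζ => ‖φ ζ - φ (Complex.exp (η * Complex.I) * ξ)‖)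
        (r * (Complex.exp (η * Complex.I) * ξ)) := by
  have hξη : ∀ η : ℝ, ‖Complex.exp (η * Complex.I) * ξ‖ = 1 := fun η => by
    rw [norm_exp_mul_I_mul, hξ]
  have hz : ∀ η : ℝ, ‖r * (Complex.exp (η * Complex.I) * ξ)‖ = r := fun η => by
    rw [norm_mul, hξη, mul_one, Complex.norm_real, Real.norm_eq_abs, abs_of_nonneg hr]
  have hc : ∀ θ : ℝ, ‖circleMap 0 1 θ‖ = 1 := fun θ => by simp
  suffices key : Continuous (Function.uncurry fun η θ : ℝ =>
      ‖φ (circleMap 0 1 θ) - φ (Complex.exp (η * Complex.I) * ξ)‖ *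
        poissonKernel 0 (r * (Complex.exp (η * Complex.I) * ξ)) (circleMap 0 1 θ)) from
    (intervalIntegral.continuous_parametric_intervalIntegral_of_continuous' (μ := volume)
      key 0 (2 * Real.pi)).const_smul (2 * Real.pi)⁻¹
  refine Continuous.mul (Continuous.norm (Continuous.sub ?_ ?_)) ?_
  · exact hφ.comp_continuous (by fun_prop) fun x => by simp
  · exact hφ.comp_continuous (by fun_prop) fun x => mem_sphere_zero_iff_norm.2 (hξη _)
  · simp only [poissonKernel_zero_of_norm_eq_one (hc _), hz]
    refine continuous_const.div (by fun_prop) fun x => ?_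
    have := one_sub_norm_le_norm_sub (z := r * (Complex.exp (x.1 * Complex.I) * ξ)) (hc x.2)
    rw [hz] at this
    have : 0 < ‖circleMap 0 1 x.2 - r * (Complex.exp (x.1 * Complex.I) * ξ)‖ := by linarith
    positivity

/-- Both forms of the growth condition on `P[|f|] - |f|` as one `L^p` estimate. -/
theorem poissonInt_norm_sub_norm_le_iff {p : ENNReal} (hp : 1 ≤ p) {ω : ℝ → ℝ}
    (hω : IsMajorant ω) {f : ℂ → ℂ} (hf : InnerProductSpace.HarmonicContOnCl f unitDisk)
    {M : ℝ} (hM : 0 ≤ M) :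
    (∀ z ∈ unitDisk,
        (p ≠ ⊤ →
          (∫ η in (0 : ℝ)..2 * Real.pi,
            (poissonInt (fun w => ‖f w‖) (z * Complex.exp (η * Complex.I)) -
              ‖f (z * Complex.exp (η * Complex.I))‖) ^ p.toReal) ^ (1 / p.toReal)
            ≤ M * ω (bdryDist z)) ∧
        (p = ⊤ → poissonInt (fun w => ‖f w‖) z - ‖f z‖ ≤ M * ω (bdryDist z))) ↔
      ∀ z ∈ unitDisk, eLpNorm (fun η : ℝ =>
        poissonInt (fun w => ‖f w‖) (Complex.exp (η * Complex.I) * z) -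
          ‖f (Complex.exp (η * Complex.I) * z)‖) p (volume.restrict (Ioc 0 (2 * Real.pi))) ≤
        ENNReal.ofReal (M * ω (1 - ‖z‖)) := by
  have hfd : ContinuousOn f unitDisk := hf.continuousOn.mono subset_closure
  have hcont : ContinuousOn (fun z => poissonInt (fun w => ‖f w‖) z - ‖f z‖) unitDisk :=
    (continuousOn_poissonInt hf.continuousOn_sphere.norm).sub hfd.norm
  have hg : ∀ z ∈ unitDisk, Continuous fun η : ℝ =>
      poissonInt (fun w => ‖f w‖) (Complex.exp (η * Complex.I) * z) -
        ‖f (Complex.exp (η * Complex.I) * z)‖ := fun z hz =>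
    continuous_comp_rotation hcont exp_mul_mem_unitDisk hz
  have hg0 : ∀ z ∈ unitDisk, 0 ≤ poissonInt (fun w => ‖f w‖) z - ‖f z‖ := fun z hz =>
    sub_nonneg.2 (norm_le_poissonInt_norm hf (mem_ball_zero_iff.1 hz))
  have hR : ∀ z ∈ unitDisk, 0 ≤ M * ω (1 - ‖z‖) := fun z hz =>
    mul_nonneg hM (hω.nonneg (by linarith [mem_ball_zero_iff.1 hz]))
  by_cases hpt : p = ⊤
  · subst hpt
    simp only [ne_eq, not_true_eq_false, false_imp_iff, true_and, true_imp_iff]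
    constructor
    · intro h z hz
      rw [eLpNorm_exponent_top]
      refine eLpNormEssSup_le_of_ae_enorm_bound (Filter.Eventually.of_forall fun η => ?_)
      have hz' := exp_mul_mem_unitDisk z hz η
      have := h _ hz'
      rw [bdryDist_of_mem hz', norm_exp_mul_I_mul] at this
      rw [Real.enorm_eq_ofReal (hg0 _ hz')]
      exact ENNReal.ofReal_le_ofReal this
    · intro h z hz
      have := enorm_le_of_eLpNorm_top_le (hg z hz) Real.two_pi_pos (h z hz)
        (left_mem_Icc.2 Real.two_pi_pos.le)
      simp only [Complex.ofReal_zero, zero_mul, Complex.exp_zero, one_mul] at this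
      rw [Real.enorm_eq_ofReal (hg0 z hz), ENNReal.ofReal_le_ofReal_iff (hR z hz)] at this
      rwa [bdryDist_of_mem hz]
  · refine forall₂_congr fun z hz => ?_
    rw [eLpNorm_eq_ofReal_integral_rpow hp hpt (hg z hz)
      (fun η => hg0 _ (exp_mul_mem_unitDisk z hz η)) Real.two_pi_pos.le,
      ENNReal.ofReal_le_ofReal_iff (hR z hz), bdryDist_of_mem hz]
    simp [hpt, mul_comm z]

/-! ### The two implications -/

theorem exists_eLpNorm_poissonInt_sub_le {p : ENNReal} (hp : 1 ≤ p) {ω : ℝ → ℝ}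
    (hω : IsMajorant ω) (hslow : IsSlow ω) {f : ℂ → ℂ}
    (hf : InnerProductSpace.HarmonicContOnCl f unitDisk) {M : ℝ} (hM : 0 < M)
    (h : ∀ z₁ ∈ unitDisk, ∀ z₂ ∈ unitDisk,
      rotNorm p f z₁ z₂ ≤ ENNReal.ofReal (M * ω ‖z₁ - z₂‖)) :
    ∃ M : ℝ, 0 < M ∧ ∀ z ∈ unitDisk, eLpNorm (fun η : ℝ =>
        poissonInt (fun w => ‖f w‖) (Complex.exp (η * Complex.I) * z) -
          ‖f (Complex.exp (η * Complex.I) * z)‖) p (volume.restrict (Ioc 0 (2 * Real.pi))) ≤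
        ENNReal.ofReal (M * ω (1 - ‖z‖)) := by
  obtain ⟨C, hC, hCω⟩ := hω.exists_lintegral_majorantWeight_le hslow
  have hcl : ∀ z₁ ∈ Metric.closedBall (0 : ℂ) 1, ∀ z₂ ∈ Metric.closedBall (0 : ℂ) 1,
      rotNorm p f z₁ z₂ ≤ ENNReal.ofReal (M * ω ‖z₁ - z₂‖) := fun z₁ h₁ z₂ h₂ =>
    rotNorm_le_of_mem_closedBall hω hM.le hf.continuousOn_ball h h₁ h₂
  have hsph := hf.continuousOn_sphere
  refine ⟨M * C + M, by positivity, fun z hz => ?_⟩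
  have hz1 : ‖z‖ < 1 := mem_ball_zero_iff.1 hz
  have hωz := hω.nonneg (show 0 ≤ 1 - ‖z‖ by linarith)
  obtain ⟨ξ, hξ, hzξ⟩ := exists_polar z
  have hξcl : ξ ∈ Metric.closedBall (0 : ℂ) 1 := by simp [hξ]
  have hzcl : z ∈ Metric.closedBall (0 : ℂ) 1 := Metric.ball_subset_closedBall hz
  have hosc := eLpNorm_poissonInt_norm_sub_le hp hω hM.le hCω hsph
    (fun ξ₁ h₁ ξ₂ h₂ => hcl ξ₁ (Metric.sphere_subset_closedBall h₁) ξ₂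
      (Metric.sphere_subset_closedBall h₂)) (norm_nonneg z) hz1 hξ
  have hrad := hcl ξ hξcl z hzcl
  have hξz : ‖ξ - z‖ = 1 - ‖z‖ := by
    have e : ξ - z = ((1 - ‖z‖ : ℝ) : ℂ) * ξ := by
      conv_lhs => rw [← hzξ]
      push_cast; ring
    rw [e, norm_mul, hξ, mul_one, Complex.norm_real, Real.norm_eq_abs, abs_of_pos (by linarith)]
  rw [hξz] at hrad
  set μ := volume.restrict (Ioc 0 (2 * Real.pi)) with hμ
  set g₁ : ℝ → ℝ := fun η => poissonInt (fun ζ => ‖f ζ - f (Complex.exp (η * Complex.I) * ξ)‖)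
      (‖z‖ * (Complex.exp (η * Complex.I) * ξ)) with hg₁
  set g₂ : ℝ → ℂ := fun η => f (Complex.exp (η * Complex.I) * ξ) -
    f (Complex.exp (η * Complex.I) * z) with hg₂
  have hg₁c : Continuous g₁ := continuous_poissonInt_norm_sub hsph (norm_nonneg z) hz1 hξ
  have hg₂c : Continuous g₂ :=
    (continuous_comp_rotation hf.continuousOn_ball exp_mul_mem_closedBall hξcl).sub
      (continuous_comp_rotation hf.continuousOn_ball exp_mul_mem_closedBall hzcl)
  calc _ ≤ eLpNorm (g₁ + fun η => ‖g₂ η‖) p μ := by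
        refine eLpNorm_mono_real fun η => ?_
        set e := Complex.exp (η * Complex.I) with he
        have hez : ‖e * z‖ < 1 := by rwa [he, norm_exp_mul_I_mul]
        have ez : ‖z‖ * (e * ξ) = e * z := by rw [mul_left_comm, hzξ]
        have hsub : ContinuousOn (fun ζ => ‖f ζ - f (e * ξ)‖) (Metric.sphere 0 1) :=
          (hsph.sub continuousOn_const).norm
        rw [Real.norm_eq_abs, abs_of_nonneg (sub_nonneg.2 (norm_le_poissonInt_norm hf hez))]
        -- Poisson integration of |f| ≤ |f - f(eξ)| + |f(eξ)| on the circle.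
        have h1 : poissonInt (fun w => ‖f w‖) (e * z) ≤
            poissonInt (fun ζ => ‖f ζ - f (e * ξ)‖) (e * z) + ‖f (e * ξ)‖ := by
          rw [← poissonInt_const ‖f (e * ξ)‖ hez, ← poissonInt_add hsub continuousOn_const hez]
          refine poissonInt_mono hsph.norm (hsub.add continuousOn_const) hez fun ζ _ => ?_
          simpa using norm_add_le (f ζ - f (e * ξ)) (f (e * ξ))
        have h2 := norm_sub_norm_le (f (e * ξ)) (f (e * z))
        simp only [Pi.add_apply, hg₁, hg₂, ← he, ez]
        linarith
    _ ≤ eLpNorm g₁ p μ + eLpNorm (fun η => ‖g₂ η‖) p μ :=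
        eLpNorm_add_le hg₁c.aestronglyMeasurable hg₂c.norm.aestronglyMeasurable hp
    _ ≤ ENNReal.ofReal (M * (C * ω (1 - ‖z‖))) + ENNReal.ofReal (M * ω (1 - ‖z‖)) := by
        rw [eLpNorm_norm]
        exact add_le_add hosc hrad
    _ = _ := by
        rw [← ENNReal.ofReal_add (by positivity) (by positivity)]
        congr 1; ring

theorem exists_rotNorm_le {p : ENNReal} (hp : 1 ≤ p) {ω : ℝ → ℝ}
    (hω : IsRegularMajorant ω) {f : ℂ → ℂ}
    (hf : InnerProductSpace.HarmonicContOnCl f unitDisk) {K : ℝ} (hK : 0 ≤ K)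
    (hqr : ∀ᵐ z ∂(volume.restrict unitDisk), maxStretch f z ^ 2 ≤ K * jac f z) {N M : ℝ}
    (hN : 0 < N) (hM : 0 < M)
    (hbd : ∀ ξ₁ ∈ Metric.sphere (0 : ℂ) 1, ∀ ξ₂ ∈ Metric.sphere (0 : ℂ) 1,
      rotNorm p (fun z => ‖f z‖) ξ₁ ξ₂ ≤ ENNReal.ofReal (N * ω ‖ξ₁ - ξ₂‖))
    (h : ∀ z ∈ unitDisk, eLpNorm (fun η : ℝ =>
        poissonInt (fun w => ‖f w‖) (Complex.exp (η * Complex.I) * z) -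
          ‖f (Complex.exp (η * Complex.I) * z)‖) p (volume.restrict (Ioc 0 (2 * Real.pi))) ≤
        ENNReal.ofReal (M * ω (1 - ‖z‖))) :
    ∃ M : ℝ, 0 < M ∧ ∀ z₁ ∈ unitDisk, ∀ z₂ ∈ unitDisk,
      rotNorm p f z₁ z₂ ≤ ENNReal.ofReal (M * ω ‖z₁ - z₂‖) := by
  obtain ⟨C, hC, hCω⟩ := hω.isMajorant.exists_lintegral_majorantWeight_le hω.slow
  refine exists_rotNorm_le_of_eLpNorm_fderiv_le hp hω.isMajorant hω.fast hf
    (C := K * 4 * (M + N * C)) (by positivity) fun z hz => ?_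
  have hz1 : ‖z‖ < 1 := mem_ball_zero_iff.1 hz
  have hd : 0 < 1 - ‖z‖ := by linarith
  have hωz := hω.isMajorant.nonneg hd.le
  have hsph := hf.continuousOn_sphere.norm
  obtain ⟨ξ, hξ, hzξ⟩ := exists_polar z
  have hosc := eLpNorm_poissonInt_norm_sub_le hp hω.isMajorant hN.le hCω hsph hbd
    (norm_nonneg z) hz1 hξ
  set μ := volume.restrict (Ioc 0 (2 * Real.pi)) with hμ
  set g₁ : ℝ → ℝ := fun η => poissonInt (fun ζ => ‖‖f ζ‖ -
      ‖f (Complex.exp (η * Complex.I) * ξ)‖‖) (‖z‖ * (Complex.exp (η * Complex.I) * ξ)) with hg₁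
  set g₂ : ℝ → ℝ := fun η => poissonInt (fun w => ‖f w‖) (Complex.exp (η * Complex.I) * z) -
    ‖f (Complex.exp (η * Complex.I) * z)‖ with hg₂
  have hg₁c : Continuous g₁ := continuous_poissonInt_norm_sub hsph (norm_nonneg z) hz1 hξ
  have hg₂c : Continuous g₂ := continuous_comp_rotation ((continuousOn_poissonInt hsph).sub
    (hf.continuousOn.mono subset_closure).norm) exp_mul_mem_unitDisk hz
  set k := K * (4 / (1 - ‖z‖)) with hk
  have hk0 : 0 ≤ k := by positivity
  calc _ ≤ eLpNorm (k • (g₂ + g₁)) p μ := by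
        refine eLpNorm_mono_real fun η => ?_
        set e := Complex.exp (η * Complex.I) with he
        have hez : ‖e * z‖ = ‖z‖ := by rw [he, norm_exp_mul_I_mul]
        have ez : ‖z‖ * (e * ξ) = e * z := by rw [mul_left_comm, hzξ]
        -- The constant c may vary with η: it is the value of |f| at the radial projection of the
        -- rotated point.
        have := norm_fderiv_le hK hf hqr ‖f (e * ξ)‖ (z := e * z) (by rwa [hez])
        rw [hez] at this
        simpa only [Pi.smul_apply, Pi.add_apply, smul_eq_mul, hg₁, hg₂, ← he, ez,
          Real.norm_eq_abs] using this
    _ = ENNReal.ofReal k * eLpNorm (g₂ + g₁) p μ := by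
        rw [eLpNorm_const_smul, Real.enorm_eq_ofReal hk0]
    _ ≤ ENNReal.ofReal k * (ENNReal.ofReal (M * ω (1 - ‖z‖)) +
          ENNReal.ofReal (N * (C * ω (1 - ‖z‖)))) := by
        gcongr
        exact (eLpNorm_add_le hg₂c.aestronglyMeasurable hg₁c.aestronglyMeasurable hp).trans
          (add_le_add (h z hz) hosc)
    _ = _ := by
        rw [← ENNReal.ofReal_add (by positivity) (by positivity), ← ENNReal.ofReal_mul hk0]
        congr 1
        rw [hk]
        field_simp

theorem mainTheorem6 (p : ENNReal) (hp : 1 ≤ p) (ω : ℝ → ℝ) (hω : IsRegularMajorant ω)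
    (f : ℂ → ℂ) (hf : InnerProductSpace.HarmonicContOnCl f unitDisk)
    (hbd : MemLipCircle ω p (fun z => ‖f z‖))
    (K : ℝ) (hK : 1 ≤ K) (hqr : IsQuasiregularOn K f unitDisk) :
    MemLipDisk ω p f ↔
      ∃ M : ℝ, 0 < M ∧ ∀ z ∈ unitDisk,
        (p ≠ ⊤ →
          (∫ η in (0 : ℝ)..2 * Real.pi,
            (poissonInt (fun w => ‖f w‖) (z * Complex.exp (η * Complex.I)) -
              ‖f (z * Complex.exp (η * Complex.I))‖) ^ p.toReal) ^ (1 / p.toReal)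
            ≤ M * ω (bdryDist z)) ∧
        (p = ⊤ → poissonInt (fun w => ‖f w‖) z - ‖f z‖ ≤ M * ω (bdryDist z)) := by
  have hfd : ContinuousOn f unitDisk := hf.continuousOn.mono subset_closure
  constructor
  · rintro ⟨-, M, hM, h⟩
    obtain ⟨M', hM', h'⟩ := exists_eLpNorm_poissonInt_sub_le hp hω.isMajorant hω.slow hf hM
      fun z₁ h₁ z₂ h₂ => rotNorm_le_of_rotDiff_le exp_mul_mem_unitDisk
        (B := fun t => ENNReal.ofReal (M * ω t)) h h₁ h₂
    exact ⟨M', hM', (poissonInt_norm_sub_norm_le_iff hp hω.isMajorant hf hM'.le).2 h'⟩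
  · rintro ⟨M, hM, h⟩
    obtain ⟨-, N, hN, hφ⟩ := hbd
    obtain ⟨M', hM', h'⟩ := exists_rotNorm_le hp hω hf (zero_le_one.trans hK) hqr.distortion hN hM
      (fun ξ₁ h₁ ξ₂ h₂ => rotNorm_le_of_rotDiff_le exp_mul_mem_sphere
        (B := fun t => ENNReal.ofReal (N * ω t)) hφ h₁ h₂)
      ((poissonInt_norm_sub_norm_le_iff hp hω.isMajorant hf hM.le).1 h)
    exact ⟨(continuousOn_iff_continuous_domRestrict.1 hfd).measurable, M', hM',
      fun z₁ h₁ z₂ h₂ => (rotDiff_le_rotNorm p hfd h₁ h₂).trans (h' z₁ h₁ z₂ h₂)⟩
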